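/- **Setting.** For density matrices $\rho,\sigma$ on a finite-dimensional Hilbert space let $d_{\mathrm{tr}}(\rho,\sigma)=\tfrac12\|\rho-\sigma\|_1$. For a distance $d$, $\mathcal N(K,d,r)$ is the smallest cardinality of a set $C\subseteq K$ such that every $x\in K$ has some $y\in C$ with $d(x,y)\le r$, and $\mathcal M(K,d,r)$ is the largest cardinality of a set $C\subseteq K$ with $d(x,y)>r$ for all distinct $x,y\in C$. Let $\epsilon,\eta\in(0,1)$, let $\mathcal U\subseteq U(2^n)$ be a class of $n$-qubit unitaries, let $S$ be a set of input states (possibly with ancillas) and $P$ a probability distribution over $S$. For each $V\in U(2^n)$ let $f_V$ be a (measurable) map from input states to output states; $f_V(\rho)$ is the output obtained from $\rho$ by applying $V$. Put $\mathcal F_{\mathcal U}=\{f_V: V\in\mathcal U\}$, $$d_P(f_V,f_W)=\sqrt{\mathbb E_{\rho\sim P}\big[d_{\mathrm{tr}}(f_V(\rho),f_W(\rho))^2\big]},\qquad \mathcal N_\eta=\sup_{\rho\in S}\mathcal N\big(\{f_V(\rho):V\in\mathcal U\},d_{\mathrm{tr}},\eta\big).$$ A learner using $N$ $\eta$-noisy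 classically described samples is a randomized algorithm that successively chooses input states $\rho_1,\dots,\rho_N\in S$ (fixed, random or adaptive), receives for each of them a state $\tilde\sigma_i$ with $d_{\mathrm{tr}}(\tilde\sigma_i,f_U(\rho_i))\le\eta$, and outputs a unitary $\hat U\in U(2^n)$ computed from the classical descriptions $(\rho_i,\tilde\sigma_i)_{i\le N}$. It learns $\mathcal U$ to accuracy $\epsilon$ if, for every $U\in\mathcal U$ and every such choice of noisy responses (a state depending on the round and on the input state), $d_P(f_{\hat U},f_U)\le\epsilon$ with probability at least $2/3$. **Theorem (information-theoretic quantum no-free-lunch).** (1) There is a universal constant $c>0$ such that, in the above setting, if some learner learns $\mathcal U$ to accuracy $\epsilon$ from $N$ $\eta$-noisy samples, then $\mathcal M(\mathcal F_{\mathcal U},d_P,2\epsilon+6\eta)$ and $\mathcal N_\eta$ are finite and $$N\cdot\log\mathcal N_\eta\;\ge\; c\,\log\mathcal M(\mathcal F_{\mathcal U},d_P,2\epsilon+6\eta)$$ (with the convention $\log 0=0$ for empty $\mathcal U$), that is, $N\ge\Omega\big(\log\mathcal M(\mathcal F_{\mathcal U},d_P,2\epsilon+6\eta)/\log\mathcal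 N_\eta\big)$. (2) A distribution $\nu$ on $U(2^n)$ is locally scrambled up to the second moment if there is a distribution $\nu'$ on $U(2^n)$ that is invariant under $U\mapsto U\,(V_1\otimes\cdots\otimes V_n)$ for all single-qubit unitaries $V_1,\dots,V_n$ and satisfies $\mathbb E_{U\sim\nu}[U^{\otimes2}\rho(U^\dagger)^{\otimes2}]=\mathbb E_{U\sim\nu'}[U^{\otimes2}\rho(U^\dagger)^{\otimes2}]$ for every $2n$-qubit density matrix $\rho$; the law $P$ of $U|0\rangle^{\otimes n}$ with $U\sim\nu$ is then called a locally scrambled ensemble of $n$-qubit pure states up to the second moment. There is a universal constant $\delta>0$, and for all $0<a\le b$ a constant $c>0$ depending only on $a,b$, such that for all $n\ge1$, all such ensembles $P$, and all $\epsilon,\eta\in(0,1)$ with $a\epsilon\le\eta\le b\epsilon$ (i.e. $\eta=\Theta(\epsilon)$) and $2\epsilon+6\eta\le\delta$: any learner that learns $\mathcal U=U(2^n)$ to accuracy $\epsilon$ from $N$ $\eta$-noisy samples, with $S$ the support of $P$ and $f_U(\rho)=U\rho U^\dagger$, uses $N\ge c\,2^n$ samples. -/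

import Mathlib

open MeasureTheory Matrix
open scoped ComplexOrder Kronecker

noncomputable section

namespace QNFL

/-! ### States, unitaries, trace distance -/

/-- Matrices carry the Borel σ-algebra; states and unitaries inherit it as subtypes. -/
instance matrixMeasurableSpace {m n : Type*} : MeasurableSpace (Matrix m n ℂ) := borel _

instance matrixBorelSpace {m n : Type*} : BorelSpace (Matrix m n ℂ) := ⟨rfl⟩

/-- Density matrices on the Hilbert space `ℂ^ι`: positive semidefinite of trace one. -/
abbrev DensityMatrix (ι : Type*) [Fintype ι] : Type _ :=
  {ρ : Matrix ι ι ℂ // ρ.PosSemidef ∧ ρ.trace = 1}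

/-- The computational basis of `n` qubits is indexed by bit strings of length `n`. -/
abbrev Qubits (n : ℕ) : Type := Fin n → Fin 2

/-- The group `U(2^n)` of `n`-qubit unitaries. -/
abbrev QubitUnitary (n : ℕ) : Type := Matrix.unitaryGroup (Qubits n) ℂ

/-- Trace distance `‖ρ - σ‖₁ / 2`; the trace norm of the Hermitian matrix `ρ - σ` is the sum of
the absolute values of its eigenvalues (with multiplicity). -/
def traceDist {ι : Type*} [Fintype ι] [DecidableEq ι] (ρ σ : DensityMatrix ι) : ℝ :=
  (1 / 2) * ∑ i, |(ρ.2.1.isHermitian.sub σ.2.1.isHermitian).eigenvalues i|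

/-- The state `U ρ U†`. -/
def conjState {ι : Type*} [Fintype ι] [DecidableEq ι] (U : Matrix.unitaryGroup ι ℂ)
    (ρ : DensityMatrix ι) : DensityMatrix ι :=
  ⟨(U : Matrix ι ι ℂ) * ρ.1 * (U : Matrix ι ι ℂ)ᴴ, ρ.2.1.mul_mul_conjTranspose_same _, by
    have h : (U : Matrix ι ι ℂ)ᴴ * (U : Matrix ι ι ℂ) = 1 := Matrix.mem_unitaryGroup_iff'.1 U.2
    rw [Matrix.trace_mul_comm, ← Matrix.mul_assoc, h, Matrix.one_mul]
    exact ρ.2.2⟩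

/-- The pure state `|0⟩⟨0|^{⊗ n}`. -/
def zeroState (n : ℕ) : DensityMatrix (Qubits n) :=
  ⟨Matrix.diagonal (Pi.single 0 1),
    Matrix.PosSemidef.diagonal (Pi.single_nonneg.2 zero_le_one),
    by simp [Matrix.trace_diagonal]⟩

/-! ### Covering and packing numbers with respect to an explicit distance -/

/-- The covering number `𝒩(K, d, r)`: smallest cardinality of a set `C ⊆ K` such that every point
of `K` is within distance `r` of a point of `C`. -/
def coveringNumber {X : Type*} (K : Set X) (d : X → X → ℝ) (r : ℝ) : ℕ∞ :=
  ⨅ (C : Set X) (_ : C ⊆ K) (_ : ∀ x ∈ K, ∃ y ∈ C, d x y ≤ r), C.encard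

/-- The packing number `ℳ(K, d, r)`: largest cardinality of a set `C ⊆ K` whose distinct points
have pairwise distance larger than `r`. -/
def packingNumber {X : Type*} (K : Set X) (d : X → X → ℝ) (r : ℝ) : ℕ∞ :=
  ⨆ (C : Set X) (_ : C ⊆ K) (_ : C.Pairwise fun x y => r < d x y), C.encard

/-- Root mean squared trace distance `√(𝔼_{ρ ∼ P} dtr(g ρ, h ρ)²)` of two maps on states. -/
def rmsDist {ι κ : Type*} [Fintype ι] [Fintype κ] [DecidableEq κ] (P : Measure (DensityMatrix ι))
    (g h : DensityMatrix ι → DensityMatrix κ) : ℝ :=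
  √(∫ ρ, traceDist (g ρ) (h ρ) ^ 2 ∂P)

/-- `𝒩_η = sup_{ρ ∈ S} 𝒩({f_V(ρ) : V ∈ 𝒰}, dtr, η)`. -/
def maxCoveringNumber {G ι κ : Type*} [Fintype ι] [Fintype κ] [DecidableEq κ]
    (f : G → DensityMatrix ι → DensityMatrix κ) (𝒰 : Set G) (S : Set (DensityMatrix ι))
    (η : ℝ) : ℕ∞ :=
  ⨆ ρ ∈ S, coveringNumber ((fun V => f V ρ) '' 𝒰) traceDist η

/-! ### Learning from noisy classically described data -/

/-- A randomized learner with random seed in `Ω`, inputs in `X`, responses in `Y` and hypotheses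
in `G`. Each input may depend on the seed and on the data collected so far (fixed inputs and inputs
drawn at random in advance are special cases); the hypothesis depends on the seed and on all the
data. -/
structure Learner (Ω X Y G : Type*) where
  query : Ω → List (X × Y) → X
  output : Ω → List (X × Y) → G

/-- The first `N` samples `(x_0, y_0), …, (x_{N-1}, y_{N-1})` that the learner with seed `ω`
collects when the response to the input `x` in round `k` is `g k x`. -/
def Learner.data {Ω X Y G : Type*} (H : Learner Ω X Y G) (g : ℕ → X → Y) (ω : Ω) :
    ℕ → List (X × Y)
  | 0 => []
  | k + 1 =>
      H.data g ω k ++ [(H.query ω (H.data g ω k), g k (H.query ω (H.data g ω k)))]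

/-- The learner `H` with inputs from `S`, whose seed has law `μ`, learns the class `𝒰` from `N`
samples with `η`-noisy responses: for every unknown `U ∈ 𝒰` and every choice of responses
within trace distance `η` of the true output states `f_U(ρ)`, its hypothesis `Û` satisfies
`d_P(f_Û, f_U) ≤ ε` with probability at least `2/3`. (The set `A` takes care of success events that
are not measurable.) -/
def Learns {Ω G ι κ : Type*} [MeasurableSpace Ω] [Fintype ι] [Fintype κ] [DecidableEq κ]
    (μ : Measure Ω) (f : G → DensityMatrix ι → DensityMatrix κ) (𝒰 : Set G)
    (S : Set (DensityMatrix ι)) (P : Measure (DensityMatrix ι)) (ε η : ℝ) (N : ℕ)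
    (H : Learner Ω S (DensityMatrix κ) G) : Prop :=
  ∀ U ∈ 𝒰, ∀ g : ℕ → S → DensityMatrix κ,
    (∀ k (ρ : S), traceDist (g k ρ) (f U ρ) ≤ η) →
    ∃ A : Set Ω, MeasurableSet A ∧ 2 / 3 ≤ μ A ∧
      ∀ ω ∈ A, rmsDist P (f (H.output ω (H.data g ω N))) (f U) ≤ ε

/-! ### Locally scrambled ensembles -/

/-- The tensor product `V_0 ⊗ ⋯ ⊗ V_{n-1}` of single-qubit unitaries. -/
def tensorUnitary {n : ℕ} (V : Fin n → Matrix.unitaryGroup (Fin 2) ℂ) : QubitUnitary n :=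
  ⟨Matrix.of fun x y => ∏ i, (V i : Matrix (Fin 2) (Fin 2) ℂ) (x i) (y i), by
    rw [Matrix.mem_unitaryGroup_iff]
    ext x y
    have h : ∀ i, ∑ z, (V i : Matrix (Fin 2) (Fin 2) ℂ) (x i) z *
        star ((V i : Matrix (Fin 2) (Fin 2) ℂ) (y i) z) = if x i = y i then 1 else 0 := by
      intro i
      have := congrFun (congrFun (Matrix.mem_unitaryGroup_iff.1 (V i).2) (x i)) (y i)
      simpa [Matrix.mul_apply, Matrix.one_apply, Matrix.star_apply] using this
    simp only [Matrix.mul_apply, Matrix.star_apply, Matrix.of_apply, Matrix.one_apply,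
      star_prod, ← Finset.prod_mul_distrib]
    have key := (Finset.prod_univ_sum (fun _ : Fin n => (Finset.univ : Finset (Fin 2)))
      (fun i z => (V i : Matrix (Fin 2) (Fin 2) ℂ) (x i) z *
        star ((V i : Matrix (Fin 2) (Fin 2) ℂ) (y i) z))).symm
    rw [Fintype.piFinset_univ, Finset.prod_congr rfl fun i _ => h i] at key
    refine key.trans ?_
    by_cases hxy : x = y
    · simp [hxy]
    · obtain ⟨i, hi⟩ := Function.ne_iff.1 hxy
      rw [if_neg hxy]
      exact Finset.prod_eq_zero (Finset.mem_univ i) (if_neg hi)⟩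

/-- `𝔼_{U ∼ ν} [U^{⊗2} ρ (U†)^{⊗2}]`, computed entrywise. -/
def secondMoment {n : ℕ} (ν : Measure (QubitUnitary n)) (ρ : DensityMatrix (Qubits n × Qubits n)) :
    Matrix (Qubits n × Qubits n) (Qubits n × Qubits n) ℂ :=
  Matrix.of fun a b =>
    ∫ U, (((U : Matrix (Qubits n) (Qubits n) ℂ) ⊗ₖ (U : Matrix (Qubits n) (Qubits n) ℂ)) * ρ.1 *
      ((U : Matrix (Qubits n) (Qubits n) ℂ) ⊗ₖ (U : Matrix (Qubits n) (Qubits n) ℂ))ᴴ) a b ∂ν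

/-- A unitary ensemble that is locally scrambled up to the second moment: its second moments agree
with those of an ensemble that is invariant under right multiplication by tensor products of
single-qubit unitaries. -/
def IsLocallyScrambledUnitary {n : ℕ} (ν : Measure (QubitUnitary n)) : Prop :=
  ∃ ν' : Measure (QubitUnitary n), IsProbabilityMeasure ν' ∧
    (∀ V : Fin n → Matrix.unitaryGroup (Fin 2) ℂ,
      ν'.map (fun U => U * tensorUnitary V) = ν') ∧
    ∀ ρ : DensityMatrix (Qubits n × Qubits n), secondMoment ν ρ = secondMoment ν' ρ

/-- An ensemble of `n`-qubit pure states that is locally scrambled up to the second moment: the law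
of `U |0⟩^{⊗n}` for a unitary ensemble that is locally scrambled up to the second moment. -/
def IsLocallyScrambled {n : ℕ} (P : Measure (DensityMatrix (Qubits n))) : Prop :=
  ∃ ν : Measure (QubitUnitary n), IsProbabilityMeasure ν ∧ IsLocallyScrambledUnitary ν ∧
    P = ν.map (fun U => conjState U (zeroState n))

end QNFL

end

noncomputable section

namespace QNFL

/-! ### Sums of absolute eigenvalues -/

section TraceNorm

variable {ι : Type*} [Fintype ι] [DecidableEq ι] {A B C : Matrix ι ι ℂ}

/-! Part (1) is a counting argument. An admissible noisy response is any state within `η` of the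
true output, so an adversary may round every output to a point of an `η`-net with at most `q = 𝒩_η`
points. For a fixed seed, the whole transcript is then determined by `N` symbols from an alphabet of
size `q`. Two targets with the same symbols produce the same hypothesis, which cannot be `ε`-close
to both when they are more than `2ε` apart. Averaging over seeds gives `(2/3) |t| ≤ q ^ N` for every
`2ε`-separated family `t`, hence `log ℳ ≤ 2 N log q` (`Learns.two_mul_card_le`,
`Learns.log_packingNumber_le`).

Part (2) compares two entropies at scale `x = 2ε + 6η`. Outputs are pure states, i.e. unit vectors
in real dimension `2 · 2^n`, so `log 𝒩_η` is at most of order `2^n log (1/η)`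
(`coveringNumber_pure_le`). The full unitary group has packing entropy at least of order `4^n log
(1/x)`, and the two logarithms are comparable because `η` is not much smaller than `ε`. The quotient
is of order `2^n`.

The packing bound has two ingredients. On a locally scrambled ensemble `d_P²` is at least `2/3` of
the infidelity `1 - |tr U†V|²/d²`: second moments may be taken from a locally invariant ensemble,
and averaging over products of the six stabilizer states bounds the mean of `|⟨X⟩|²`
(`sum_norm_stabExpect_sq_le`). Separation in infidelity comes from choosing half of the columns one
after another, each from a large separated set in the orthogonal complement of its predecessors
(`exists_orthonormal_tree`). Small infidelity forces three quarters of these columns to agree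
approximately, so few tuples lie near a given one, and greedy selection leaves many separated
unitaries (`exists_separated_unitaries`). -/

theorem inner_toEuclideanLin_eq_sum (hB : B.IsHermitian) (x : EuclideanSpace ℂ ι) :
    inner ℂ x (toEuclideanLin B x) =
      ∑ j, (hB.eigenvalues j * ‖inner ℂ (hB.eigenvectorBasis j) x‖ ^ 2 : ℂ) := by
  rw [← hB.eigenvectorBasis.sum_inner_mul_inner]
  refine Finset.sum_congr rfl fun j _ => ?_
  have hs := isSymmetric_toEuclideanLin_iff.2 hB
  have hv : toEuclideanLin B (hB.eigenvectorBasis j) =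
      (hB.eigenvalues j : ℂ) • hB.eigenvectorBasis j := by
    have := hB.mulVec_eigenvectorBasis j
    apply (WithLp.equiv 2 _).injective
    simpa [Matrix.toLpLin_apply] using this
  rw [← hs, hv, inner_smul_left, Complex.conj_ofReal, mul_left_comm, ← inner_conj_symm x,
    Complex.conj_mul']

theorem inner_eigenvectorBasis (hB : B.IsHermitian) (i : ι) :
    inner ℂ (hB.eigenvectorBasis i) (toEuclideanLin B (hB.eigenvectorBasis i)) =
      (hB.eigenvalues i : ℂ) := by
  rw [inner_toEuclideanLin_eq_sum hB, Finset.sum_eq_single i]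
  · simp [hB.eigenvectorBasis.norm_eq_one]
  · intro j _ hj
    simp [hB.eigenvectorBasis.inner_eq_zero hj]
  · simp

/-- The diagonal of a Hermitian matrix in any orthonormal basis is dominated by the trace norm. -/
theorem sum_norm_inner_le_sum_abs_eigenvalues (hB : B.IsHermitian)
    (u : OrthonormalBasis ι ℂ (EuclideanSpace ℂ ι)) :
    ∑ i, ‖inner ℂ (u i) (toEuclideanLin B (u i))‖ ≤ ∑ j, |hB.eigenvalues j| := by
  calc ∑ i, ‖inner ℂ (u i) (toEuclideanLin B (u i))‖
      ≤ ∑ i, ∑ j, |hB.eigenvalues j| * ‖inner ℂ (hB.eigenvectorBasis j) (u i)‖ ^ 2 := by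
        refine Finset.sum_le_sum fun i _ => ?_
        rw [inner_toEuclideanLin_eq_sum hB]
        refine (norm_sum_le _ _).trans (Finset.sum_le_sum fun j _ => ?_)
        simp
    _ = ∑ j, |hB.eigenvalues j| := by
        rw [Finset.sum_comm]
        refine Finset.sum_congr rfl fun j _ => ?_
        rw [← Finset.mul_sum, u.sum_sq_norm_inner_left, hB.eigenvectorBasis.norm_eq_one]
        simp

theorem sum_abs_eigenvalues_eq (hA : A.IsHermitian) :
    ∑ i, |hA.eigenvalues i| =
      ∑ i, ‖inner ℂ (hA.eigenvectorBasis i) (toEuclideanLin A (hA.eigenvectorBasis i))‖ := by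
  refine Finset.sum_congr rfl fun i _ => ?_
  rw [inner_eigenvectorBasis hA]
  simp

/-- The trace norm is the maximum over orthonormal bases of the sum of absolute diagonal entries.
Evaluating both summands in the eigenbasis of `A` therefore yields the triangle inequality. -/
theorem sum_abs_eigenvalues_add_le (hA : A.IsHermitian) (hB : B.IsHermitian) (hC : C.IsHermitian)
    (h : A = B + C) :
    ∑ i, |hA.eigenvalues i| ≤ ∑ i, |hB.eigenvalues i| + ∑ i, |hC.eigenvalues i| := by
  rw [sum_abs_eigenvalues_eq hA]
  refine le_trans ?_ (add_le_add
    (sum_norm_inner_le_sum_abs_eigenvalues hB hA.eigenvectorBasis)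
    (sum_norm_inner_le_sum_abs_eigenvalues hC hA.eigenvectorBasis))
  rw [← Finset.sum_add_distrib]
  refine Finset.sum_le_sum fun i _ => ?_
  generalize hA.eigenvectorBasis = u
  subst h
  rw [map_add, LinearMap.add_apply, inner_add_right]
  exact norm_add_le _ _

theorem sum_abs_eigenvalues_neg_le (hA : A.IsHermitian) (hB : B.IsHermitian) (h : A = -B) :
    ∑ i, |hA.eigenvalues i| ≤ ∑ i, |hB.eigenvalues i| := by
  rw [sum_abs_eigenvalues_eq hA]
  refine le_trans (le_of_eq ?_) (sum_norm_inner_le_sum_abs_eigenvalues hB hA.eigenvectorBasis)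
  refine Finset.sum_congr rfl fun i _ => ?_
  generalize hA.eigenvectorBasis = u
  subst h
  rw [map_neg, LinearMap.neg_apply, inner_neg_right, norm_neg]

theorem sum_eigenvalues_sq (hA : A.IsHermitian) :
    ((∑ i, hA.eigenvalues i ^ 2 : ℝ) : ℂ) = (A * A).trace := by
  have h : A * A = (Unitary.conjStarAlgAut ℂ (Matrix ι ι ℂ) hA.eigenvectorUnitary)
      (diagonal (RCLike.ofReal ∘ hA.eigenvalues) * diagonal (RCLike.ofReal ∘ hA.eigenvalues)) := by
    rw [map_mul, ← hA.spectral_theorem]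
  rw [h, Unitary.conjStarAlgAut_apply, Matrix.trace_mul_cycle]
  simp [Matrix.trace_diagonal, pow_two]

theorem sum_eigenvalues_sq_eq_sum_norm_sq (hA : A.IsHermitian) :
    ∑ i, hA.eigenvalues i ^ 2 = ∑ i, ∑ j, ‖A i j‖ ^ 2 := by
  have h := sum_eigenvalues_sq hA
  have h2 : (A * A).trace = ((∑ i, ∑ j, ‖A i j‖ ^ 2 : ℝ) : ℂ) := by
    simp only [Matrix.trace, Matrix.diag, Matrix.mul_apply]
    push_cast
    refine Finset.sum_congr rfl fun i _ => Finset.sum_congr rfl fun j _ => ?_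
    rw [← hA.apply j i, ← Complex.mul_conj']
    rfl
  rw [h2] at h
  exact_mod_cast h

theorem sum_abs_eigenvalues_sq_le (hA : A.IsHermitian) :
    (∑ i, |hA.eigenvalues i|) ^ 2 ≤ Fintype.card ι * ∑ i, ∑ j, ‖A i j‖ ^ 2 := by
  rw [← sum_eigenvalues_sq_eq_sum_norm_sq hA]
  have := sq_sum_le_card_mul_sum_sq (s := Finset.univ) (f := fun i => |hA.eigenvalues i|)
  simpa using this

/-- Cauchy–Schwarz over the nonzero eigenvalues only. For rank two and trace zero the result matches
`two_mul_sum_eigenvalues_sq_le`, which pins down the trace distance of pure states. -/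
theorem sum_abs_eigenvalues_sq_le_rank (hA : A.IsHermitian) :
    (∑ i, |hA.eigenvalues i|) ^ 2 ≤ A.rank * ∑ i, hA.eigenvalues i ^ 2 := by
  have h := sq_sum_le_card_mul_sum_sq (s := Finset.univ.filter fun i => hA.eigenvalues i ≠ 0)
    (f := fun i => |hA.eigenvalues i|)
  rw [hA.rank_eq_card_non_zero_eigs, Fintype.card_subtype]
  rw [Finset.sum_filter_of_ne (fun i _ hi => by simpa using hi),
    Finset.sum_filter_of_ne (fun i _ hi => by simpa using hi)] at h
  simpa using h

/-- For a traceless Hermitian matrix the squares of the eigenvalues sum to at most half of the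
squared trace norm. -/
theorem two_mul_sum_eigenvalues_sq_le (hA : A.IsHermitian) (h0 : A.trace = 0) :
    2 * ∑ i, hA.eigenvalues i ^ 2 ≤ (∑ i, |hA.eigenvalues i|) ^ 2 := by
  have hs : ∑ i, hA.eigenvalues i = 0 := by
    have := hA.trace_eq_sum_eigenvalues
    rw [h0] at this
    apply Complex.ofReal_injective
    push_cast
    exact this.symm
  set l := hA.eigenvalues
  -- Trace zero makes the positive and negative parts of the spectrum have equal mass, half the
  -- trace norm each. In each part the sum of squares is at most the square of the sum.
  have hp : ∑ i, max (l i) 0 = (∑ i, |l i|) / 2 := by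
    have : ∀ i, max (l i) 0 = (|l i| + l i) / 2 := fun i => by
      rcases le_total 0 (l i) with h | h
      · rw [max_eq_left h, abs_of_nonneg h]; ring
      · rw [max_eq_right h, abs_of_nonpos h]; ring
    simp_rw [this]
    rw [← Finset.sum_div, Finset.sum_add_distrib, hs, add_zero]
  have hm : ∑ i, max (-l i) 0 = (∑ i, |l i|) / 2 := by
    have : ∀ i, max (-l i) 0 = (|l i| - l i) / 2 := fun i => by
      rcases le_total 0 (l i) with h | h
      · rw [max_eq_right (by linarith), abs_of_nonneg h]; ring
      · rw [max_eq_left (by linarith), abs_of_nonpos h]; ring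
    simp_rw [this]
    rw [← Finset.sum_div, Finset.sum_sub_distrib, hs, sub_zero]
  have h1 : ∑ i, max (l i) 0 ^ 2 ≤ (∑ i, max (l i) 0) ^ 2 :=
    Finset.sum_sq_le_sq_sum_of_nonneg fun i _ => le_max_right _ _
  have h2 : ∑ i, max (-l i) 0 ^ 2 ≤ (∑ i, max (-l i) 0) ^ 2 :=
    Finset.sum_sq_le_sq_sum_of_nonneg fun i _ => le_max_right _ _
  have h3 : ∑ i, l i ^ 2 = ∑ i, max (l i) 0 ^ 2 + ∑ i, max (-l i) 0 ^ 2 := by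
    rw [← Finset.sum_add_distrib]
    refine Finset.sum_congr rfl fun i _ => ?_
    rcases le_total 0 (l i) with h | h
    · rw [max_eq_left h, max_eq_right (by linarith)]; ring
    · rw [max_eq_right h, max_eq_left (by linarith)]; ring
  rw [hp] at h1
  rw [hm] at h2
  rw [h3]
  nlinarith

end TraceNorm

/-! ### The trace distance -/

section TraceDist

variable {ι : Type*} [Fintype ι]

instance secondCountableTopology_matrix : SecondCountableTopology (Matrix ι ι ℂ) :=
  inferInstanceAs (SecondCountableTopology (ι → ι → ℂ))

instance secondCountableTopology_densityMatrix : SecondCountableTopology (DensityMatrix ι) :=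
  TopologicalSpace.Subtype.secondCountableTopology _

variable [DecidableEq ι]

theorem traceDist_nonneg (ρ σ : DensityMatrix ι) : 0 ≤ traceDist ρ σ :=
  mul_nonneg (by norm_num) (Finset.sum_nonneg fun _ _ => abs_nonneg _)

theorem traceDist_triangle (ρ σ τ : DensityMatrix ι) :
    traceDist ρ τ ≤ traceDist ρ σ + traceDist σ τ := by
  have := sum_abs_eigenvalues_add_le (ρ.2.1.isHermitian.sub τ.2.1.isHermitian)
    (ρ.2.1.isHermitian.sub σ.2.1.isHermitian) (σ.2.1.isHermitian.sub τ.2.1.isHermitian)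
    (by abel)
  unfold traceDist
  linarith

theorem traceDist_comm (ρ σ : DensityMatrix ι) : traceDist ρ σ = traceDist σ ρ := by
  have h : ∀ ρ σ : DensityMatrix ι, traceDist ρ σ ≤ traceDist σ ρ := fun ρ σ =>
    mul_le_mul_of_nonneg_left (sum_abs_eigenvalues_neg_le _ _ (by abel)) (by norm_num)
  exact le_antisymm (h _ _) (h _ _)

theorem sum_abs_eigenvalues_densityMatrix (ρ : DensityMatrix ι) :
    ∑ i, |ρ.2.1.isHermitian.eigenvalues i| = 1 := by
  have h := ρ.2.1.isHermitian.trace_eq_sum_eigenvalues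
  rw [Finset.sum_congr rfl fun i _ => abs_of_nonneg (ρ.2.1.eigenvalues_nonneg i)]
  apply Complex.ofReal_injective
  push_cast
  exact h.symm.trans ρ.2.2

theorem traceDist_le_one (ρ σ : DensityMatrix ι) : traceDist ρ σ ≤ 1 := by
  have h1 := sum_abs_eigenvalues_add_le (ρ.2.1.isHermitian.sub σ.2.1.isHermitian)
    ρ.2.1.isHermitian σ.2.1.isHermitian.neg (sub_eq_add_neg _ _)
  have h2 := sum_abs_eigenvalues_neg_le σ.2.1.isHermitian.neg σ.2.1.isHermitian rfl
  rw [sum_abs_eigenvalues_densityMatrix] at h1 h2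
  unfold traceDist
  linarith

theorem traceDist_le_of_norm_sub_le {ρ σ : DensityMatrix ι} {δ : ℝ} (hδ : 0 ≤ δ)
    (h : ∀ i j, ‖ρ.1 i j - σ.1 i j‖ ≤ δ) : traceDist ρ σ ≤ (Fintype.card ι : ℝ) ^ 2 * δ := by
  have h1 := sum_abs_eigenvalues_sq_le (ρ.2.1.isHermitian.sub σ.2.1.isHermitian)
  have h2 : ∑ i, ∑ j, ‖(ρ.1 - σ.1) i j‖ ^ 2 ≤ ∑ _i : ι, ∑ _j : ι, δ ^ 2 :=
    Finset.sum_le_sum fun i _ => Finset.sum_le_sum fun j _ =>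
      pow_le_pow_left₀ (norm_nonneg _) (h i j) 2
  -- Cauchy–Schwarz gives the exponent `3/2` in the dimension. It is rounded up to `2`, since only
  -- continuity and total boundedness rest on this estimate.
  have hn : (Fintype.card ι : ℝ) ≤ (Fintype.card ι : ℝ) ^ 2 := by
    exact_mod_cast Nat.le_self_pow two_ne_zero _
  simp only [Finset.sum_const, Finset.card_univ, nsmul_eq_mul] at h2
  have h3 : ∑ i, |(ρ.2.1.isHermitian.sub σ.2.1.isHermitian).eigenvalues i| ≤
      (Fintype.card ι : ℝ) ^ 2 * δ := by
    refine abs_le_of_sq_le_sq' ?_ (by positivity) |>.2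
    refine h1.trans ((mul_le_mul_of_nonneg_left h2 (by positivity)).trans ?_)
    calc (Fintype.card ι : ℝ) * (Fintype.card ι * (Fintype.card ι * δ ^ 2))
        = Fintype.card ι * ((Fintype.card ι : ℝ) ^ 2 * δ ^ 2) := by ring
      _ ≤ (Fintype.card ι : ℝ) ^ 2 * ((Fintype.card ι : ℝ) ^ 2 * δ ^ 2) :=
        mul_le_mul_of_nonneg_right hn (by positivity)
      _ = _ := by ring
  have : 0 ≤ (Fintype.card ι : ℝ) ^ 2 * δ := by positivity
  unfold traceDist
  linarith

theorem traceDist_self (ρ : DensityMatrix ι) : traceDist ρ ρ = 0 :=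
  le_antisymm (by simpa using traceDist_le_of_norm_sub_le (ρ := ρ) (σ := ρ) le_rfl (by simp))
    (traceDist_nonneg _ _)

theorem tendsto_traceDist_nhds (ρ : DensityMatrix ι) :
    Filter.Tendsto (fun σ => traceDist σ ρ) (nhds ρ) (nhds 0) := by
  rw [Metric.tendsto_nhds]
  intro e he
  set δ : ℝ := e / ((Fintype.card ι : ℝ) ^ 2 + 1)
  have hδ : 0 < δ := by positivity
  have hev : ∀ᶠ σ : DensityMatrix ι in nhds ρ, ∀ i j, ‖σ.1 i j - ρ.1 i j‖ < δ := by
    rw [Filter.eventually_all]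
    intro i
    rw [Filter.eventually_all]
    intro j
    have hc : Continuous fun σ : DensityMatrix ι => ‖σ.1 i j - ρ.1 i j‖ :=
      ((continuous_subtype_val.matrix_elem i j).sub continuous_const).norm
    have := hc.tendsto ρ
    simp only [sub_self, norm_zero] at this
    exact this.eventually_lt_const hδ
  filter_upwards [hev] with σ hσ
  rw [Real.dist_0_eq_abs, abs_of_nonneg (traceDist_nonneg _ _)]
  refine (traceDist_le_of_norm_sub_le hδ.le fun i j => (hσ i j).le).trans_lt ?_
  rw [mul_div_assoc', div_lt_iff₀ (by positivity)]
  nlinarith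

/-- By the triangle inequality, joint continuity reduces to `traceDist σ ρ → 0` as `σ → ρ`. -/
theorem continuous_traceDist :
    Continuous fun p : DensityMatrix ι × DensityMatrix ι => traceDist p.1 p.2 := by
  rw [continuous_iff_continuousAt]
  rintro ⟨ρ, σ⟩
  unfold ContinuousAt
  rw [tendsto_iff_dist_tendsto_zero]
  have h : Filter.Tendsto (fun p : DensityMatrix ι × DensityMatrix ι =>
      traceDist p.1 ρ + traceDist p.2 σ) (nhds (ρ, σ)) (nhds 0) := by
    rw [← add_zero (0 : ℝ)]
    exact ((tendsto_traceDist_nhds ρ).comp (continuous_fst.tendsto (ρ, σ))).add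
      ((tendsto_traceDist_nhds σ).comp (continuous_snd.tendsto (ρ, σ)))
  refine squeeze_zero (fun _ => dist_nonneg) (fun p => ?_) h
  have h1 := traceDist_triangle p.1 ρ p.2
  have h2 := traceDist_triangle ρ σ p.2
  have h3 := traceDist_triangle ρ p.1 σ
  have h4 := traceDist_triangle p.1 p.2 σ
  have h5 := traceDist_comm p.1 ρ
  have h6 := traceDist_comm p.2 σ
  rw [Real.dist_eq, abs_le]
  constructor <;> linarith

theorem norm_apply_le_one (ρ : DensityMatrix ι) (i j : ι) : ‖ρ.1 i j‖ ≤ 1 := by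
  have h := sum_eigenvalues_sq_eq_sum_norm_sq ρ.2.1.isHermitian
  have h1 : ∑ i, |ρ.2.1.isHermitian.eigenvalues i| ^ 2 ≤
      (∑ i, |ρ.2.1.isHermitian.eigenvalues i|) ^ 2 :=
    Finset.sum_sq_le_sq_sum_of_nonneg fun i _ => abs_nonneg _
  rw [sum_abs_eigenvalues_densityMatrix] at h1
  simp only [sq_abs] at h1
  have h2 : ‖ρ.1 i j‖ ^ 2 ≤ ∑ i, ∑ j, ‖ρ.1 i j‖ ^ 2 :=
    (Finset.single_le_sum (f := fun j => ‖ρ.1 i j‖ ^ 2) (fun _ _ => by positivity)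
      (Finset.mem_univ j)).trans
      (Finset.single_le_sum (f := fun i => ∑ j, ‖ρ.1 i j‖ ^ 2) (fun _ _ => by positivity)
        (Finset.mem_univ i))
  have := norm_nonneg (ρ.1 i j)
  nlinarith

/-- The set of states can be partitioned into finitely many cells of small trace diameter. -/
theorem exists_finite_cells {η : ℝ} (hη : 0 < η) :
    ∃ (M : ℕ) (cell : DensityMatrix ι → Fin M),
      ∀ ρ σ, cell ρ = cell σ → traceDist ρ σ ≤ η := by
  set δ : ℝ := η / (2 * ((Fintype.card ι : ℝ) ^ 2 + 1))
  have hδ : 0 < δ := by positivity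
  have htb : TotallyBounded (Metric.closedBall (0 : ι → ι → ℂ) 1) :=
    (isCompact_closedBall _ _).totallyBounded
  obtain ⟨t, htf, ht⟩ := Metric.totallyBounded_iff.1 htb δ hδ
  let e : DensityMatrix ι → ι → ι → ℂ := fun ρ i j => ρ.1 i j
  have hmem : ∀ ρ : DensityMatrix ι, ∃ y : t, dist (e ρ) y < δ := by
    intro ρ
    have : (e ρ) ∈ Metric.closedBall (0 : ι → ι → ℂ) 1 := by
      rw [mem_closedBall_zero_iff, pi_norm_le_iff_of_nonneg zero_le_one]
      intro i
      rw [pi_norm_le_iff_of_nonneg zero_le_one]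
      exact fun j => norm_apply_le_one ρ i j
    have := ht this
    simp only [Set.mem_iUnion, Metric.mem_ball] at this
    obtain ⟨y, hy, h⟩ := this
    exact ⟨⟨y, hy⟩, h⟩
  choose c hc using hmem
  have := htf.fintype
  refine ⟨Fintype.card t, fun ρ => Fintype.equivFin t (c ρ), fun ρ σ h => ?_⟩
  have hcc : c ρ = c σ := (Fintype.equivFin t).injective h
  have hd : dist (e ρ) (e σ) ≤ 2 * δ := by
    have h1 := hc ρ
    have h2 := hc σ
    rw [← hcc] at h2
    have h3 := dist_triangle_right (e ρ) (e σ) (c ρ)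
    linarith
  refine (traceDist_le_of_norm_sub_le (δ := 2 * δ) (by positivity) fun i j => ?_).trans ?_
  · rw [← dist_eq_norm]
    exact ((dist_le_pi_dist (e ρ i) (e σ i) j).trans
      (dist_le_pi_dist (e ρ) (e σ) i)).trans hd
  · have : 2 * δ = η / ((Fintype.card ι : ℝ) ^ 2 + 1) := by
      simp only [δ]; field_simp
    rw [this, mul_div_assoc', div_le_iff₀ (by positivity)]
    nlinarith

end TraceDist

/-! ### Covering numbers, packing numbers and the root mean squared distance -/

section Covering

variable {X : Type*} {K : Set X} {d : X → X → ℝ} {r : ℝ}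

theorem coveringNumber_le_of_cells {M : ℕ} (cell : X → Fin M)
    (h : ∀ x ∈ K, ∀ y ∈ K, cell x = cell y → d x y ≤ r) : coveringNumber K d r ≤ M := by
  classical
  have hch : ∀ i : (cell '' K), ∃ x ∈ K, cell x = i := fun i => i.2
  choose p hpK hp using hch
  have h1 : coveringNumber K d r ≤ (Set.range p).encard := by
    refine iInf₂_le_of_le (Set.range p) ?_ (iInf_le_of_le ?_ le_rfl)
    · rintro _ ⟨i, rfl⟩; exact hpK i
    · exact fun x hx => ⟨p ⟨cell x, x, hx, rfl⟩, ⟨_, rfl⟩,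
        h _ hx _ (hpK _) (hp ⟨cell x, x, hx, rfl⟩).symm⟩
  refine h1.trans ?_
  rw [← Set.image_univ]
  refine (Set.encard_image_le _ _).trans ?_
  rw [Set.encard_univ]
  calc ENat.card (cell '' K) ≤ ENat.card (Fin M) :=
        ENat.card_le_card_of_injective Subtype.val_injective
    _ = M := by simp

theorem exists_cover_of_coveringNumber_le {q : ℕ} (h : coveringNumber K d r ≤ q) :
    ∃ C : Set X, C ⊆ K ∧ (∀ x ∈ K, ∃ y ∈ C, d x y ≤ r) ∧ C.encard ≤ q := by
  -- The covering number is an infimum in `ℕ∞`. A strict bound by `q + 1` extracts an actual cover.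
  have h' : coveringNumber K d r < (q + 1 : ℕ) :=
    h.trans_lt (by exact_mod_cast Nat.lt_succ_self q)
  unfold coveringNumber at h'
  simp only [iInf_lt_iff] at h'
  obtain ⟨C, hCK, hC, hlt⟩ := h'
  refine ⟨C, hCK, hC, ?_⟩
  rw [Nat.cast_add, Nat.cast_one] at hlt
  exact Order.le_of_lt_add_one hlt

/-- A cover with at most `q` points can be listed by `Fin q`. -/
theorem exists_decoder_of_coveringNumber_le {q : ℕ} (hK : K.Nonempty)
    (h : coveringNumber K d r ≤ q) : ∃ dec : Fin q → X, ∀ x ∈ K, ∃ s, d x (dec s) ≤ r := by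
  obtain ⟨C, -, hC, hq⟩ := exists_cover_of_coveringNumber_le h
  have hfin : C.Finite := Set.finite_of_encard_le_coe hq
  obtain ⟨x0, hx0⟩ := hK
  obtain ⟨y0, hy0, -⟩ := hC x0 hx0
  have hf := hfin.fintype
  have hcard : Fintype.card C ≤ q := by
    rw [← Set.coe_fintypeCard] at hq
    exact_mod_cast hq
  have hne : Nonempty C := ⟨⟨y0, hy0⟩⟩
  let e : C ↪ Fin q := (Fintype.equivFin C).toEmbedding.trans (Fin.castLEEmb hcard)
  -- Indices outside the range of `e` decode to an arbitrary point of `C`, which is harmless.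
  refine ⟨fun s => (Function.invFun e s : C), fun x hx => ?_⟩
  obtain ⟨y, hy, hd⟩ := hC x hx
  refine ⟨e ⟨y, hy⟩, ?_⟩
  dsimp only
  rw [Function.leftInverse_invFun e.injective]
  exact hd

theorem coveringNumber_pos (hK : K.Nonempty) : 1 ≤ coveringNumber K d r := by
  unfold coveringNumber
  refine le_iInf fun C => le_iInf fun _ => le_iInf fun hC => ?_
  obtain ⟨x, hx⟩ := hK
  obtain ⟨y, hy, -⟩ := hC x hx
  exact Set.one_le_encard_iff_nonempty.2 ⟨y, hy⟩

/-- Separation passes to subsets, and a set with more than `B` points, finite or not, contains one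
with exactly `B + 1`. -/
theorem packingNumber_le_of_forall_finset {B : ℕ}
    (h : ∀ t : Finset X, (t : Set X) ⊆ K → ((t : Set X).Pairwise fun x y => r < d x y) →
      t.card ≤ B) : packingNumber K d r ≤ B := by
  refine iSup_le fun C => iSup_le fun hCK => iSup_le fun hC => ?_
  by_contra hlt
  rw [not_le] at hlt
  have h1 : ((B + 1 : ℕ) : ℕ∞) ≤ C.encard := by
    rw [Nat.cast_add, Nat.cast_one]
    exact Order.add_one_le_of_lt hlt
  obtain ⟨t, htC, ht⟩ := Set.exists_subset_encard_eq h1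
  have htf : t.Finite := Set.finite_of_encard_eq_coe ht
  have h2 := h htf.toFinset (by simpa using htC.trans hCK) (by simpa using hC.mono htC)
  rw [htf.encard_eq_coe_toFinset_card] at ht
  have h3 : htf.toFinset.card = B + 1 := by exact_mod_cast ht
  omega

theorem card_le_packingNumber (t : Finset X) (ht : (t : Set X) ⊆ K)
    (hp : (t : Set X).Pairwise fun x y => r < d x y) : (t.card : ℕ∞) ≤ packingNumber K d r := by
  rw [← Set.encard_coe_eq_coe_finsetCard]
  exact le_iSup_of_le (t : Set X) (le_iSup_of_le ht (le_iSup_of_le hp le_rfl))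

end Covering

/-- Minkowski's inequality in `L²`: expand the square and bound the cross term by Cauchy–Schwarz. -/
theorem sqrt_integral_sq_le_add {α : Type*} [MeasurableSpace α] {P : Measure α} {a b c : α → ℝ}
    (ha : ∀ x, 0 ≤ a x) (hb : ∀ x, 0 ≤ b x) (hc : ∀ x, 0 ≤ c x) (hb2 : MemLp b 2 P)
    (hc2 : MemLp c 2 P) (habc : ∀ x, a x ≤ b x + c x) :
    √(∫ x, a x ^ 2 ∂P) ≤ √(∫ x, b x ^ 2 ∂P) + √(∫ x, c x ^ 2 ∂P) := by
  have hcs := integral_mul_le_Lp_mul_Lq_of_nonneg Real.HolderConjugate.two_two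
    (Filter.Eventually.of_forall hb) (Filter.Eventually.of_forall hc)
    (by simpa using hb2) (by simpa using hc2)
  simp only [Real.rpow_two, ← Real.sqrt_eq_rpow] at hcs
  have hbi := hb2.integrable_sq
  have hci := hc2.integrable_sq
  have hbc : Integrable (fun x => b x * c x) P := hb2.integrable_mul hc2
  apply Real.sqrt_le_iff.2 ⟨by positivity, ?_⟩
  calc ∫ x, a x ^ 2 ∂P ≤ ∫ x, (b x ^ 2 + 2 * (b x * c x) + c x ^ 2) ∂P := by
        refine integral_mono_of_nonneg (Filter.Eventually.of_forall fun x => by positivity)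
          ((hbi.add (hbc.const_mul 2)).add hci) (Filter.Eventually.of_forall fun x => ?_)
        have := pow_le_pow_left₀ (ha x) (habc x) 2
        dsimp only
        linarith
    _ = ∫ x, b x ^ 2 ∂P + 2 * ∫ x, b x * c x ∂P + ∫ x, c x ^ 2 ∂P := by
        have hbc' : Integrable (fun x => 2 * (b x * c x)) P := hbc.const_mul 2
        have hs : Integrable (fun x => b x ^ 2 + 2 * (b x * c x)) P := hbi.add hbc'
        rw [integral_add hs hci, integral_add hbi hbc', integral_const_mul]
    _ ≤ _ := by
        have h1 := Real.sq_sqrt (integral_nonneg (μ := P) fun x => sq_nonneg (b x))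
        have h2 := Real.sq_sqrt (integral_nonneg (μ := P) fun x => sq_nonneg (c x))
        nlinarith

section RmsDist

variable {ι κ : Type*} [Fintype ι] [Fintype κ] [DecidableEq κ] {P : Measure (DensityMatrix ι)}
  {f g h : DensityMatrix ι → DensityMatrix κ}

theorem measurable_traceDist_comp (hf : Measurable f) (hg : Measurable g) :
    Measurable fun ρ => traceDist (f ρ) (g ρ) := by
  have h : Measurable fun p : DensityMatrix κ × DensityMatrix κ => traceDist p.1 p.2 :=
    continuous_traceDist.measurable
  exact Measurable.comp (f := fun ρ => (f ρ, g ρ)) h (Measurable.prodMk hf hg)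

theorem memLp_traceDist_comp [IsFiniteMeasure P] (hf : Measurable f) (hg : Measurable g) :
    MemLp (fun ρ => traceDist (f ρ) (g ρ)) 2 P :=
  MemLp.of_bound (measurable_traceDist_comp hf hg).aestronglyMeasurable 1
    (Filter.Eventually.of_forall fun ρ => by
      rw [Real.norm_of_nonneg (traceDist_nonneg _ _)]
      exact traceDist_le_one _ _)

theorem rmsDist_comm : rmsDist P f g = rmsDist P g f := by
  simp only [rmsDist, traceDist_comm (f _) (g _)]

theorem rmsDist_self : rmsDist P f f = 0 := by
  simp [rmsDist, traceDist_self]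

theorem rmsDist_triangle [IsFiniteMeasure P] (hf : Measurable f) (hg : Measurable g)
    (hh : Measurable h) : rmsDist P f h ≤ rmsDist P f g + rmsDist P g h :=
  sqrt_integral_sq_le_add (fun _ => traceDist_nonneg _ _) (fun _ => traceDist_nonneg _ _)
    (fun _ => traceDist_nonneg _ _) (memLp_traceDist_comp hf hg) (memLp_traceDist_comp hg hh)
    (fun _ => traceDist_triangle _ _ _)

end RmsDist

/-! ### Counting transcripts -/

/-- For an adaptive learner agreement of the responses is meaningful only at a common query, so it
is demanded only once the earlier transcripts agree. The induction supplies that agreement. -/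
theorem Learner.data_congr {Ω X Y G : Type*} (H : Learner Ω X Y G) {g g' : ℕ → X → Y} {ω : Ω}
    {N : ℕ} (h : ∀ k < N, H.data g ω k = H.data g' ω k →
      g k (H.query ω (H.data g ω k)) = g' k (H.query ω (H.data g ω k))) :
    H.data g ω N = H.data g' ω N := by
  induction N with
  | zero => rfl
  | succ k ih =>
    have h1 := ih fun j hj => h j (hj.trans (Nat.lt_succ_self k))
    have h2 := h k (Nat.lt_succ_self k) h1
    simp only [Learner.data]
    rw [← h1, h2]

/-- Double counting: exchanging sum and integral turns the sum of probabilities into the expected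
number of events that occur. -/
theorem sum_measure_le_of_card_le {Ω T : Type*} [MeasurableSpace Ω] {μ : Measure Ω}
    [IsProbabilityMeasure μ] (t : Finset T) (A : T → Set Ω) (hA : ∀ i ∈ t, MeasurableSet (A i))
    (B : ℕ) [∀ ω, DecidablePred fun i => ω ∈ A i]
    (h : ∀ ω, (t.filter fun i => ω ∈ A i).card ≤ B) : ∑ i ∈ t, μ (A i) ≤ B := by
  calc ∑ i ∈ t, μ (A i) = ∑ i ∈ t, ∫⁻ ω, (A i).indicator 1 ω ∂μ :=
        Finset.sum_congr rfl fun i hi => (lintegral_indicator_one (hA i hi)).symm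
    _ = ∫⁻ ω, ∑ i ∈ t, (A i).indicator 1 ω ∂μ :=
        (lintegral_finsetSum _ fun i hi => measurable_one.indicator (hA i hi)).symm
    _ ≤ ∫⁻ _, (B : ENNReal) ∂μ := by
        refine lintegral_mono fun ω => ?_
        have : ∑ i ∈ t, (A i).indicator (1 : Ω → ENNReal) ω =
            ((t.filter fun i => ω ∈ A i).card : ENNReal) := by
          rw [Finset.card_filter]
          push_cast
          exact Finset.sum_congr rfl fun i _ => by simp [Set.indicator_apply]
        rw [this]
        exact Nat.cast_le.2 (h ω)
    _ = B := by simp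

/-! ### Rounding adversary and the sample bound -/

section Learning

variable {G Ω ι κ : Type*} [MeasurableSpace Ω] [Fintype ι] [Fintype κ] [DecidableEq κ]
  {μ : Measure Ω} [IsProbabilityMeasure μ] {f : G → DensityMatrix ι → DensityMatrix κ} {𝒰 : Set G}
  {S : Set (DensityMatrix ι)} {P : Measure (DensityMatrix ι)} [IsProbabilityMeasure P] {ε η : ℝ}
  {N : ℕ} {H : Learner Ω S (DensityMatrix κ) G}

/-- If the true outputs can be rounded to one of `q` admissible responses, then a learner can
distinguish at most `(3/2) q ^ N` targets. -/
theorem Learns.two_mul_card_le (hf : ∀ V, Measurable (f V)) (hL : Learns μ f 𝒰 S P ε η N H)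
    {q : ℕ} (dec : S → Fin q → DensityMatrix κ)
    (hdec : ∀ ρ : S, ∀ U ∈ 𝒰, ∃ s, traceDist (f U ρ) (dec ρ s) ≤ η)
    (t : Finset (DensityMatrix ι → DensityMatrix κ)) (ht : (t : Set (DensityMatrix ι → DensityMatrix κ)) ⊆ f '' 𝒰)
    (hsep : (t : Set (DensityMatrix ι → DensityMatrix κ)).Pairwise fun g h => 2 * ε < rmsDist P g h) :
    2 * t.card ≤ 3 * q ^ N := by
  classical
  have hrep : ∀ φ : t, ∃ U ∈ 𝒰, f U = φ := fun φ => ht φ.2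
  choose rep hrep𝒰 hrep using hrep
  have henc : ∀ (ρ : S) (φ : t), ∃ s, traceDist (f (rep φ) ρ) (dec ρ s) ≤ η :=
    fun ρ φ => hdec ρ _ (hrep𝒰 φ)
  choose enc henc using henc
  -- The adversary answers with the decoded symbol. For a given query, the target influences the
  -- response only through one of `q` symbols.
  let g : t → ℕ → S → DensityMatrix κ := fun φ _ ρ => dec ρ (enc ρ φ)
  have hA := fun φ : t => hL (rep φ) (hrep𝒰 φ) (g φ) fun _ ρ => by
    rw [traceDist_comm]; exact henc ρ φ
  choose A hAm hAμ hA using hA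
  let x : Ω → t → Fin N → Fin q := fun ω φ k => enc (H.query ω (H.data (g φ) ω k)) φ
  have hcount : ∀ ω, (Finset.univ.filter fun φ : t => ω ∈ A φ).card ≤ q ^ N := by
    intro ω
    -- For a fixed seed, successful targets with equal symbol sequences have equal transcripts.
    -- Their common hypothesis is within `ε` of both, against separation by more than `2ε`.
    have hinj : Set.InjOn (x ω) (Finset.univ.filter fun φ : t => ω ∈ A φ) := by
      intro φ hφ ψ hψ hx
      simp only [Finset.coe_filter, Finset.mem_univ, true_and, Set.mem_ofPred_eq] at hφ hψ
      have hdata : H.data (g φ) ω N = H.data (g ψ) ω N := by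
        refine H.data_congr fun k hk hkk => ?_
        have := congrFun hx ⟨k, hk⟩
        simp only [x] at this
        simp only [g]
        rw [this, hkk]
      by_contra hne
      have h1 := hA φ ω hφ
      have h2 := hA ψ ω hψ
      rw [← hdata] at h2
      have h3 := hsep φ.2 ψ.2 fun h => hne (Subtype.ext h)
      rw [← hrep φ, ← hrep ψ] at h3
      have h4 := rmsDist_triangle (P := P) (hf (rep φ)) (hf (H.output ω (H.data (g φ) ω N)))
        (hf (rep ψ))
      rw [rmsDist_comm] at h1
      linarith
    have := Finset.card_le_card_of_injOn (t := Finset.univ) (x ω) (by simp) hinj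
    simpa using this
  have hsum := sum_measure_le_of_card_le (μ := μ) Finset.univ A (fun φ _ => hAm φ) (q ^ N) hcount
  have h2 : ∑ _φ : t, (2 / 3 : ENNReal) ≤ ((q ^ N : ℕ) : ENNReal) :=
    (Finset.sum_le_sum fun φ _ => hAμ φ).trans hsum
  rw [Finset.sum_const, Finset.card_univ, Fintype.card_coe, nsmul_eq_mul, ← mul_div_assoc,
    ENNReal.div_le_iff (by norm_num) (by norm_num)] at h2
  have h3 : t.card * 2 ≤ q ^ N * 3 := by exact_mod_cast h2
  omega

theorem maxCoveringNumber_ne_top (f : G → DensityMatrix ι → DensityMatrix κ) (𝒰 : Set G)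
    (S : Set (DensityMatrix ι)) (hη : 0 < η) : maxCoveringNumber f 𝒰 S η ≠ ⊤ := by
  obtain ⟨M, cell, hcell⟩ := exists_finite_cells (ι := κ) hη
  have : maxCoveringNumber f 𝒰 S η ≤ M :=
    iSup₂_le fun ρ _ => coveringNumber_le_of_cells cell fun x _ y _ h => hcell x y h
  exact ne_top_of_le_ne_top (ENat.natCast_ne_top M) this

/-- The information-theoretic bound on the number of noisy samples. -/
theorem Learns.log_packingNumber_le (hf : ∀ V, Measurable (f V)) (hPS : ∀ᵐ ρ ∂P, ρ ∈ S)
    (hη : 0 < η) {r : ℝ} (hr : 2 * ε ≤ r) (hL : Learns μ f 𝒰 S P ε η N H) :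
    packingNumber (f '' 𝒰) (rmsDist P) r ≠ ⊤ ∧ maxCoveringNumber f 𝒰 S η ≠ ⊤ ∧
      1 / 2 * Real.log (packingNumber (f '' 𝒰) (rmsDist P) r).toNat ≤
        N * Real.log (maxCoveringNumber f 𝒰 S η).toNat := by
  have hfin := maxCoveringNumber_ne_top f 𝒰 S hη
  -- The empty class is treated apart: `q` may be `0` there, and `Real.log 0 = 0` realizes the
  -- stated convention.
  rcases 𝒰.eq_empty_or_nonempty with rfl | h𝒰
  · have h0 : packingNumber (f '' (∅ : Set G)) (rmsDist P) r ≤ (0 : ℕ) := by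
      refine packingNumber_le_of_forall_finset fun t ht _ => ?_
      rw [Set.image_empty, Set.subset_empty_iff, Finset.coe_eq_empty] at ht
      simp [ht]
    have h0' : packingNumber (f '' (∅ : Set G)) (rmsDist P) r = 0 := by simpa using h0
    refine ⟨by rw [h0']; exact ENat.zero_ne_top, hfin, ?_⟩
    rw [h0']
    have := Real.log_natCast_nonneg (maxCoveringNumber f ∅ S η).toNat
    simp only [ENat.toNat_zero, Nat.cast_zero, Real.log_zero, mul_zero]
    positivity
  set q := (maxCoveringNumber f 𝒰 S η).toNat with hq
  have hqc : (q : ℕ∞) = maxCoveringNumber f 𝒰 S η := ENat.natCast_toNat hfin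
  have hcov : ∀ ρ : S, coveringNumber ((fun V => f V ρ) '' 𝒰) traceDist η ≤ q := fun ρ => by
    rw [hqc]
    exact le_iSup₂_of_le ρ.1 ρ.2 le_rfl
  have hdec := fun ρ : S => exists_decoder_of_coveringNumber_le (h𝒰.image _) (hcov ρ)
  choose dec hdec using hdec
  obtain ⟨ρ0, hρ0⟩ : S.Nonempty := hPS.exists
  have hq1 : 1 ≤ q := by
    have h1 := (coveringNumber_pos (d := traceDist) (r := η)
      (h𝒰.image (fun V => f V ρ0))).trans (hcov ⟨ρ0, hρ0⟩)
    exact_mod_cast h1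
  have hcard : ∀ t : Finset (DensityMatrix ι → DensityMatrix κ), (t : Set (DensityMatrix ι → DensityMatrix κ)) ⊆ f '' 𝒰 →
      ((t : Set (DensityMatrix ι → DensityMatrix κ)).Pairwise fun g h => r < rmsDist P g h) → 2 * t.card ≤ 3 * q ^ N :=
    fun t ht hsep => hL.two_mul_card_le hf dec
      (fun ρ U hU => hdec ρ _ ⟨U, hU, rfl⟩) t ht
      (hsep.mono' fun _ _ h => hr.trans_lt h)
  have hle : packingNumber (f '' 𝒰) (rmsDist P) r ≤ ((3 * q ^ N / 2 : ℕ) : ℕ∞) :=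
    packingNumber_le_of_forall_finset fun t ht hsep => by
      have := hcard t ht hsep
      omega
  have hMfin := ne_top_of_le_ne_top (ENat.natCast_ne_top _) hle
  refine ⟨hMfin, hfin, ?_⟩
  set m := (packingNumber (f '' 𝒰) (rmsDist P) r).toNat with hm
  have hmle : 2 * m ≤ 3 * q ^ N := by
    rw [← ENat.natCast_toNat hMfin, ← hm] at hle
    have : m ≤ 3 * q ^ N / 2 := by exact_mod_cast hle
    omega
  -- The factor `3/2` is absorbed by squaring: if `q ^ N = 1`, integrality already gives `m ≤ 1`.
  -- This is the origin of the constant `1/2`.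
  have hm2 : m ≤ (q ^ N) ^ 2 := by
    have hQ : 1 ≤ q ^ N := Nat.one_le_pow _ _ hq1
    rcases Nat.lt_or_ge (q ^ N) 2 with h | h
    · have : q ^ N = 1 := by omega
      rw [this] at hmle ⊢
      omega
    · nlinarith
  rcases Nat.eq_zero_or_pos m with h0 | hpos
  · rw [h0]
    have := Real.log_natCast_nonneg q
    simp only [Nat.cast_zero, Real.log_zero, mul_zero]
    positivity
  · have h1 : Real.log m ≤ Real.log (((q : ℝ) ^ N) ^ 2) :=
      Real.log_le_log (by exact_mod_cast hpos) (by exact_mod_cast hm2)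
    rw [Real.log_pow, Real.log_pow] at h1
    push_cast at h1
    linarith

end Learning

/-! ### Volume bounds for separated sets -/

section Volume

variable {F : Type*} [NormedAddCommGroup F] [NormedSpace ℝ F] [FiniteDimensional ℝ F]

/-- Balls of radius `r / 2` about the points are disjoint and lie in the ball of radius `1 + r / 2`.
Compare Haar volumes. -/
theorem card_le_of_separated_closedBall {r : ℝ} (hr : 0 < r) (t : Finset F)
    (ht : ∀ x ∈ t, ‖x‖ ≤ 1) (hsep : (t : Set F).Pairwise fun x y => r < dist x y) :
    (t.card : ℝ) ≤ (1 + 2 / r) ^ Module.finrank ℝ F := by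
  borelize F
  let μ : Measure F := Measure.addHaar
  set D := Module.finrank ℝ F
  have hdisj : (t : Set F).PairwiseDisjoint fun x => Metric.ball x (r / 2) := by
    intro x hx y hy hxy
    refine Metric.ball_disjoint_ball ?_
    have := hsep hx hy hxy
    linarith
  have hsub : (⋃ x ∈ t, Metric.ball x (r / 2)) ⊆ Metric.ball (0 : F) (1 + r / 2) := by
    refine Set.iUnion₂_subset fun x hx => Metric.ball_subset_ball' ?_
    rw [dist_zero_right]
    linarith [ht x hx]
  have h := measure_mono (μ := μ) hsub
  rw [measure_biUnion_finset hdisj fun _ _ => measurableSet_ball,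
    Measure.addHaar_ball_of_pos _ _ (by positivity)] at h
  simp_rw [Measure.addHaar_ball_of_pos μ _ (half_pos hr)] at h
  rw [Finset.sum_const, nsmul_eq_mul, ← mul_assoc] at h
  have hpos : μ (Metric.ball (0 : F) 1) ≠ 0 := (Metric.measure_ball_pos μ _ one_pos).ne'
  have h2 := (ENNReal.mul_le_mul_iff_left hpos measure_ball_lt_top.ne).1 h
  rw [← ENNReal.ofReal_natCast, ← ENNReal.ofReal_mul (by positivity),
    ENNReal.ofReal_le_ofReal_iff (by positivity)] at h2
  have h3 : (1 + 2 / r) ^ D * (r / 2) ^ D = (1 + r / 2) ^ D := by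
    rw [← mul_pow]
    congr 1
    field_simp
    ring
  rw [← h3] at h2
  exact le_of_mul_le_mul_right h2 (by positivity)

/-- A separated set of maximal cardinality is an `r`-net, so its closed `r`-balls must fill the
volume of the unit ball. The previous upper bound guarantees that a maximum exists. -/
theorem exists_separated_closedBall {r : ℝ} (hr : 0 < r) :
    ∃ t : Finset F, (∀ x ∈ t, ‖x‖ ≤ 1) ∧ ((t : Set F).Pairwise fun x y => r < dist x y) ∧
      (1 / r) ^ Module.finrank ℝ F ≤ (t.card : ℝ) := by
  classical
  borelize F
  let μ : Measure F := Measure.addHaar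
  set D := Module.finrank ℝ F
  let T : Set ℕ := {n | ∃ t : Finset F, ((∀ x ∈ t, ‖x‖ ≤ 1) ∧
    ((t : Set F).Pairwise fun x y => r < dist x y)) ∧ t.card = n}
  have hne : T.Nonempty := ⟨0, ∅, by simp, rfl⟩
  have hbdd : BddAbove T := by
    refine ⟨⌊(1 + 2 / r) ^ D⌋₊, ?_⟩
    rintro _ ⟨t, ⟨ht, hsep⟩, rfl⟩
    exact Nat.le_floor (card_le_of_separated_closedBall hr t ht hsep)
  obtain ⟨t, ⟨ht, hsep⟩, hcard⟩ := Nat.sSup_mem hne hbdd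
  refine ⟨t, ht, hsep, ?_⟩
  have hcov : Metric.closedBall (0 : F) 1 ⊆ ⋃ x ∈ t, Metric.closedBall x r := by
    intro y hy
    rw [mem_closedBall_zero_iff] at hy
    by_contra hnot
    simp only [Set.mem_iUnion, Metric.mem_closedBall, not_exists, not_le] at hnot
    have hyt : y ∉ t := fun h => by
      have := hnot y h
      rw [dist_self] at this
      linarith
    have hmem : (insert y t).card ∈ T := by
      refine ⟨insert y t, ⟨?_, ?_⟩, rfl⟩
      · intro x hx
        rcases Finset.mem_insert.1 hx with rfl | hx
        exacts [hy, ht x hx]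
      · rw [Finset.coe_insert]
        refine hsep.insert fun x hx _ => ⟨hnot x hx, ?_⟩
        rw [dist_comm]
        exact hnot x hx
    have := le_csSup hbdd hmem
    rw [Finset.card_insert_of_notMem hyt, ← hcard] at this
    omega
  have h := (measure_mono (μ := μ) hcov).trans (measure_biUnion_finset_le t _)
  rw [Measure.addHaar_closedBall _ _ zero_le_one] at h
  simp_rw [Measure.addHaar_closedBall μ _ hr.le] at h
  rw [Finset.sum_const, nsmul_eq_mul, ← mul_assoc] at h
  have hpos : μ (Metric.ball (0 : F) 1) ≠ 0 := (Metric.measure_ball_pos μ _ one_pos).ne'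
  have h2 := (ENNReal.mul_le_mul_iff_left hpos measure_ball_lt_top.ne).1 h
  rw [← ENNReal.ofReal_natCast, ← ENNReal.ofReal_mul (by positivity),
    ENNReal.ofReal_le_ofReal_iff (by positivity), one_pow] at h2
  rw [one_div, inv_pow, inv_le_iff_one_le_mul₀ (by positivity)]
  exact h2

end Volume

/-! ### Separated families of orthonormal vectors -/

section Orthonormal

variable {E : Type*} [NormedAddCommGroup E] [InnerProductSpace ℂ E]

/-- Overlap of the normalizations of `e + z` and `e + w` for `z`, `w` orthogonal to `e`. -/
theorem one_sub_norm_inner_normalized_ge {e z w : E} (he : ‖e‖ = 1) (hz : inner ℂ e z = 0)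
    (hw : inner ℂ e w = 0) (hz1 : ‖z‖ ≤ 1) (hw1 : ‖w‖ ≤ 1) :
    ‖z - w‖ ^ 2 / 8 ≤
      1 - ‖inner ℂ ((‖e + z‖⁻¹ : ℂ) • (e + z)) ((‖e + w‖⁻¹ : ℂ) • (e + w))‖ := by
  have hnz : ‖e + z‖ ^ 2 = 1 + ‖z‖ ^ 2 := by
    have := norm_add_sq_eq_norm_sq_add_norm_sq_of_inner_eq_zero e z hz
    rw [he] at this
    nlinarith
  have hnw : ‖e + w‖ ^ 2 = 1 + ‖w‖ ^ 2 := by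
    have := norm_add_sq_eq_norm_sq_add_norm_sq_of_inner_eq_zero e w hw
    rw [he] at this
    nlinarith
  have hi : inner ℂ (e + z) (e + w) = 1 + inner ℂ z w := by
    have hz' : inner ℂ z e = 0 := inner_eq_zero_symm.1 hz
    rw [inner_add_left, inner_add_right, inner_add_right, hw, hz', inner_self_eq_norm_sq_to_K, he]
    simp
  have hzp : 0 < ‖e + z‖ := by
    have := norm_nonneg (e + z)
    rcases this.eq_or_lt with h | h
    · rw [← h] at hnz; nlinarith [sq_nonneg ‖z‖]
    · exact h
  have hwp : 0 < ‖e + w‖ := by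
    have := norm_nonneg (e + w)
    rcases this.eq_or_lt with h | h
    · rw [← h] at hnw; nlinarith [sq_nonneg ‖w‖]
    · exact h
  rw [inner_smul_left, inner_smul_right, hi]
  simp only [norm_mul, RCLike.norm_conj, norm_inv, Complex.norm_real, norm_norm]
  set x := ‖(1 : ℂ) + inner ℂ z w‖ with hx
  set c := inner ℂ z w with hc
  have hx2 : x ^ 2 = 1 + 2 * c.re + ‖c‖ ^ 2 := by
    rw [hx, Complex.sq_norm, Complex.sq_norm, Complex.normSq_apply, Complex.normSq_apply]
    simp
    ring
  have hcs : ‖c‖ ≤ ‖z‖ * ‖w‖ := norm_inner_le_norm z w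
  have hd : ‖z - w‖ ^ 2 = ‖z‖ ^ 2 - 2 * c.re + ‖w‖ ^ 2 := by
    have := norm_sub_sq (𝕜 := ℂ) z w
    simpa using this
  set y := ‖e + z‖⁻¹ * (‖e + w‖⁻¹ * x) with hy
  have hy0 : 0 ≤ y := by positivity
  have hy2 : y ^ 2 * ((1 + ‖z‖ ^ 2) * (1 + ‖w‖ ^ 2)) = x ^ 2 := by
    rw [← hnz, ← hnw, hy]
    field_simp
  have hzn := norm_nonneg z
  have hwn := norm_nonneg w
  have hcn := norm_nonneg c
  have h4 : (1 + ‖z‖ ^ 2) * (1 + ‖w‖ ^ 2) ≤ 4 := by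
    have h1 : 1 + ‖z‖ ^ 2 ≤ 2 := by nlinarith
    have h2 : 1 + ‖w‖ ^ 2 ≤ 2 := by nlinarith
    nlinarith [sq_nonneg ‖z‖, sq_nonneg ‖w‖]
  have hcs2 : ‖c‖ ^ 2 ≤ ‖z‖ ^ 2 * ‖w‖ ^ 2 := by
    rw [← mul_pow]; exact pow_le_pow_left₀ hcn hcs 2
  set K := (1 + ‖z‖ ^ 2) * (1 + ‖w‖ ^ 2) with hK
  have hK1 : 1 ≤ K := by rw [hK]; nlinarith [sq_nonneg ‖z‖, sq_nonneg ‖w‖]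
  -- `K - x²` equals `‖z - w‖² + (‖z‖²‖w‖² - ‖c‖²)`, and the bracket is nonnegative by
  -- Cauchy–Schwarz. Then `K ≤ 4` and `1 - y² ≤ 2 (1 - y)` give the factor `8`.
  have hdK : ‖z - w‖ ^ 2 ≤ K * (1 - y ^ 2) := by
    have : K * (1 - y ^ 2) = K - x ^ 2 := by rw [← hy2]; ring
    rw [this, hx2, hd, hK]
    nlinarith
  have hy1 : 0 ≤ 1 - y ^ 2 := by
    by_contra hneg
    nlinarith [sq_nonneg ‖z - w‖]
  have hfin : ‖z - w‖ ^ 2 ≤ 4 * (1 - y ^ 2) := hdK.trans (mul_le_mul_of_nonneg_right h4 hy1)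
  nlinarith [sq_nonneg (1 - y)]

theorem norm_add_ne_zero_of_inner_eq_zero {e z : E} (he : ‖e‖ = 1) (hz : inner ℂ e z = 0) :
    ‖e + z‖ ≠ 0 := by
  have := norm_add_sq_eq_norm_sq_add_norm_sq_of_inner_eq_zero e z hz
  intro h
  rw [h, he] at this
  nlinarith [mul_self_nonneg ‖z‖]

/-- Many unit vectors with pairwise small overlap in the orthogonal complement of a small
orthonormal family. -/
theorem exists_separated_unit_vectors [FiniteDimensional ℂ E] {k L : ℕ} (u : Fin k → E)
    (hkL : k + 1 + L ≤ Module.finrank ℂ E) {r : ℝ} (hr : 0 < r) (hr1 : r ≤ 1) {q : ℕ}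
    (hq : (q : ℝ) ≤ (1 / r) ^ (2 * L)) :
    ∃ t : Finset E, t.card = q ∧ (∀ w ∈ t, ‖w‖ = 1 ∧ ∀ i, inner ℂ (u i) w = 0) ∧
      (t : Set E).Pairwise fun v w => r ^ 2 / 8 < 1 - ‖(inner ℂ v w : ℂ)‖ := by
  classical
  have hspan : Module.finrank ℂ (Submodule.span ℂ (Set.range u)) ≤ k := by
    simpa [Set.finrank] using finrank_range_le_card (R := ℂ) u
  have hsum := (Submodule.span ℂ (Set.range u)).finrank_add_finrank_orthogonal
  have hpos : 0 < Module.finrank ℂ (Submodule.span ℂ (Set.range u))ᗮ := by omega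
  have : Nontrivial (Submodule.span ℂ (Set.range u))ᗮ := Module.finrank_pos_iff.1 hpos
  obtain ⟨e0, he0⟩ := exists_norm_eq (Submodule.span ℂ (Set.range u))ᗮ zero_le_one
  obtain ⟨e, heu⟩ := e0
  have he : ‖e‖ = 1 := he0
  have hue : ∀ i, inner ℂ (u i) e = 0 := fun i =>
    (Submodule.mem_orthogonal _ _).1 heu _ (Submodule.subset_span ⟨i, rfl⟩)
  -- One dimension is spent on the base point `e`. The remaining complement `W` parametrizes unit
  -- vectors near `e` by `z ↦ (e + z)/‖e + z‖`, a chart on which overlaps detect distance without a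
  -- phase ambiguity.
  let v : Fin (k + 1) → E := Fin.snoc u e
  let W := (Submodule.span ℂ (Set.range v))ᗮ
  have hspan' : Module.finrank ℂ (Submodule.span ℂ (Set.range v)) ≤ k + 1 := by
    simpa [Set.finrank] using finrank_range_le_card (R := ℂ) v
  have hsum' := (Submodule.span ℂ (Set.range v)).finrank_add_finrank_orthogonal
  have hW : L ≤ Module.finrank ℂ W := by
    simp only [W]
    omega
  have hvW : ∀ (z : W) i, inner ℂ (v i) (z : E) = 0 := fun z i =>
    (Submodule.mem_orthogonal _ _).1 z.2 _ (Submodule.subset_span ⟨i, rfl⟩)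
  have heW : ∀ z : W, inner ℂ e (z : E) = 0 := fun z => by
    simpa [v] using hvW z (Fin.last k)
  have huW : ∀ (z : W) i, inner ℂ (u i) (z : E) = 0 := fun z i => by
    simpa [v] using hvW z i.castSucc
  have : FiniteDimensional ℝ W := FiniteDimensional.complexToReal W
  obtain ⟨t, ht1, htsep, htcard⟩ := exists_separated_closedBall (F := W) hr
  rw [finrank_real_of_complex] at htcard
  have hqt : q ≤ t.card := by
    -- As a real space `W` has dimension at least `2 L`, whence the exponent.
    have h1 : (1 / r) ^ (2 * L) ≤ (1 / r) ^ (2 * Module.finrank ℂ W) :=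
      pow_le_pow_right₀ (by rw [le_div_iff₀ hr]; linarith) (by omega)
    exact_mod_cast hq.trans (h1.trans htcard)
  obtain ⟨t', ht't, ht'⟩ := Finset.exists_subset_card_eq hqt
  let φ : W → E := fun z => (‖e + z‖⁻¹ : ℂ) • (e + z)
  have hφ : ∀ z ∈ t', ∀ w ∈ t', z ≠ w → r ^ 2 / 8 < 1 - ‖(inner ℂ (φ z) (φ w) : ℂ)‖ := by
    intro z hz w hw hne
    refine lt_of_lt_of_le ?_ (one_sub_norm_inner_normalized_ge he (heW z) (heW w)
      (ht1 z (ht't hz)) (ht1 w (ht't hw)))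
    have h1 : r < dist z w := htsep (ht't hz) (ht't hw) hne
    rw [dist_eq_norm] at h1
    have h2 : r < ‖(z : E) - w‖ := h1
    have := pow_lt_pow_left₀ h2 hr.le two_ne_zero
    linarith
  have hnorm : ∀ z : W, ‖φ z‖ = 1 := fun z => by
    have := norm_add_ne_zero_of_inner_eq_zero he (heW z)
    simp only [φ, norm_smul, norm_inv, Complex.norm_real, norm_norm]
    exact inv_mul_cancel₀ this
  have hinj : Set.InjOn φ t' := by
    intro z hz w hw h
    by_contra hne
    have h1 := hφ z hz w hw hne
    rw [h, inner_self_eq_norm_sq_to_K, hnorm] at h1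
    simp at h1
    nlinarith
  refine ⟨t'.image φ, by rw [Finset.card_image_of_injOn hinj, ht'], ?_, ?_⟩
  · intro w hw
    obtain ⟨z, -, rfl⟩ := Finset.mem_image.1 hw
    refine ⟨hnorm z, fun i => ?_⟩
    simp only [φ]
    rw [inner_smul_right, inner_add_right, hue, huW, add_zero, mul_zero]
  · intro a ha b hb hab
    rw [Finset.mem_coe, Finset.mem_image] at ha hb
    obtain ⟨z, hz, rfl⟩ := ha
    obtain ⟨w, hw, rfl⟩ := hb
    exact hφ z hz w hw fun h => hab (by rw [h])

/-- Two unit vectors with large overlap with a third one have large overlap. -/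
theorem one_sub_norm_inner_le {u v w : E} (hu : ‖u‖ = 1) (hv : ‖v‖ = 1) (hw : ‖w‖ = 1) {s : ℝ}
    (huv : 1 - ‖(inner ℂ u v : ℂ)‖ ≤ s) (hwv : 1 - ‖(inner ℂ w v : ℂ)‖ ≤ s) :
    1 - ‖(inner ℂ u w : ℂ)‖ ≤ 4 * s := by
  -- Rotating `x` by a phase makes its inner product with `y` real and nonnegative, so overlap
  -- becomes Euclidean distance and the triangle inequality applies.
  have key : ∀ x y : E, ‖x‖ = 1 → ‖y‖ = 1 → ∃ c : ℂ, ‖c‖ = 1 ∧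
      ‖c • x - y‖ ^ 2 = 2 * (1 - ‖(inner ℂ x y : ℂ)‖) := by
    intro x y hx hy
    obtain ⟨c, hc, hcxy⟩ := RCLike.exists_norm_eq_mul_self (inner ℂ x y : ℂ)
    refine ⟨star c, by simpa using hc, ?_⟩
    have h := norm_sub_sq (𝕜 := ℂ) (star c • x) y
    rw [inner_smul_left, norm_smul, hx, hy] at h
    have h2 : (starRingEnd ℂ) (star c) * inner ℂ x y = (‖(inner ℂ x y : ℂ)‖ : ℂ) := by
      rw [Complex.star_def, Complex.conj_conj]
      exact hcxy.symm
    rw [h2] at h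
    rw [h]
    simp [hc]
    ring
  obtain ⟨a, ha, hau⟩ := key u v hu hv
  obtain ⟨b, hb, hbw⟩ := key w v hw hv
  have h1 : ‖a • u - b • w‖ ≤ ‖a • u - v‖ + ‖b • w - v‖ := by
    have := norm_sub_le (a • u - v) (b • w - v)
    simpa using this
  have h2 : ‖a • u - b • w‖ ^ 2 ≤ 8 * s := by
    have := pow_le_pow_left₀ (norm_nonneg _) h1 2
    nlinarith [sq_nonneg (‖a • u - v‖ - ‖b • w - v‖)]
  have h3 := norm_sub_sq (𝕜 := ℂ) (a • u) (b • w)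
  have h4 : RCLike.re (inner ℂ (a • u) (b • w)) ≤ ‖(inner ℂ u w : ℂ)‖ := by
    refine (RCLike.re_le_norm _).trans ?_
    rw [inner_smul_left, inner_smul_right, norm_mul, norm_mul, RCLike.norm_conj, ha, hb]
    simp
  rw [norm_smul, norm_smul, ha, hb, hu, hw] at h3
  linarith

/-- A tree of orthonormal tuples, each node having `q` children, in which few tuples have large
overlap with a given tuple outside of a small set of positions. -/
theorem exists_orthonormal_tree [FiniteDimensional ℂ E] {L : ℕ} {r s : ℝ} (hr : 0 < r)
    (hr1 : r ≤ 1) (hrs : 4 * s ≤ r ^ 2 / 8) {q : ℕ} (hq : (q : ℝ) ≤ (1 / r) ^ (2 * L)) (k : ℕ)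
    (hk : k + L ≤ Module.finrank ℂ E) :
    ∃ T : Finset (Fin k → E), T.card = q ^ k ∧ (∀ u ∈ T, Orthonormal ℂ u) ∧
      ∀ (v : Fin k → E), (∀ i, ‖v i‖ = 1) → ∀ B : Finset (Fin k), ∀ T' ⊆ T,
        (∀ u ∈ T', ∀ i ∉ B, 1 - ‖(inner ℂ (u i) (v i) : ℂ)‖ ≤ s) → T'.card ≤ q ^ B.card := by
  classical
  induction k with
  | zero =>
    refine ⟨{Fin.elim0}, by simp, ?_, ?_⟩
    · intro u _
      exact ⟨fun i => i.elim0, fun i => i.elim0⟩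
    · intro v _ B T' hT' _
      have hB : B = ∅ := by ext i; exact i.elim0
      rw [hB, Finset.card_empty, pow_zero]
      simpa using Finset.card_le_card hT'
  | succ k ih =>
    obtain ⟨T, hTc, hTo, hT⟩ := ih (by omega)
    have hch := fun u : Fin k → E =>
      exists_separated_unit_vectors (L := L) u (by omega) hr hr1 hq
    choose ch hchc hch hchs using hch
    let ext : (Σ _ : Fin k → E, E) → Fin (k + 1) → E := fun p => Fin.snoc p.1 p.2
    have hinj : Function.Injective ext := by
      rintro ⟨u, w⟩ ⟨u', w'⟩ h
      have h1 : u = u' := by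
        funext i
        simpa [ext] using congrFun h i.castSucc
      have h2 : w = w' := by simpa [ext] using congrFun h (Fin.last k)
      rw [h1, h2]
    refine ⟨(T.sigma ch).image ext, ?_, ?_, ?_⟩
    · rw [Finset.card_image_of_injective _ hinj, Finset.card_sigma]
      simp [hchc, hTc, pow_succ]
    · intro x hx
      obtain ⟨⟨u, w⟩, hp, rfl⟩ := Finset.mem_image.1 hx
      rw [Finset.mem_sigma] at hp
      have ho := hTo u hp.1
      obtain ⟨hw1, hw2⟩ := hch u w hp.2
      have hw2' : ∀ i, inner ℂ w (u i) = 0 := fun i => inner_eq_zero_symm.1 (hw2 i)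
      constructor
      · intro i
        refine Fin.lastCases ?_ (fun i => ?_) i
        · simpa [ext] using hw1
        · simpa [ext] using ho.1 i
      · intro i j
        refine Fin.lastCases ?_ (fun i => ?_) i <;> refine Fin.lastCases ?_ (fun j => ?_) j
        · intro h; exact absurd rfl h
        · intro _; simpa [ext] using hw2' j
        · intro _; simpa [ext] using hw2 i
        · intro h
          have := ho.2 (i := i) (j := j) fun h' => h (by rw [h'])
          simpa [ext] using this
    · intro v hv B T' hT' hclose
      let B0 : Finset (Fin k) := Finset.univ.filter fun i => i.castSucc ∈ B
      let T0 : Finset (Fin k → E) := T'.image fun x i => x i.castSucc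
      have hmem : ∀ x ∈ T', (fun i : Fin k => x i.castSucc) ∈ T ∧
          x (Fin.last k) ∈ ch fun i : Fin k => x i.castSucc := by
        intro x hx
        obtain ⟨⟨u, w⟩, hp, rfl⟩ := Finset.mem_image.1 (hT' hx)
        rw [Finset.mem_sigma] at hp
        simpa [ext] using hp
      have hT0 : T0.card ≤ q ^ B0.card := by
        refine hT (fun i => v i.castSucc) (fun i => hv _) B0 T0 ?_ ?_
        · intro u hu
          obtain ⟨x, hx, rfl⟩ := Finset.mem_image.1 hu
          exact (hmem x hx).1
        · intro u hu i hi
          obtain ⟨x, hx, rfl⟩ := Finset.mem_image.1 hu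
          exact hclose x hx _ (by simpa [B0] using hi)
      have hB : B.card = B0.card + if Fin.last k ∈ B then 1 else 0 := by
        have h1 : B.card = ∑ i : Fin (k + 1), if i ∈ B then 1 else 0 := by simp
        rw [h1, Fin.sum_univ_castSucc, Finset.card_filter]
      -- A last position in `B` leaves all `q` children possible. Outside `B` at most one child
      -- survives: two siblings both close to `v` would have overlap deficit at most `4 s ≤ r ^ 2 /
      -- 8`, contradicting their separation.
      have hfib : ∀ u ∈ T0, (T'.filter fun x => (fun i : Fin k => x i.castSucc) = u).card ≤
          if Fin.last k ∈ B then q else 1 := by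
        intro u _
        have hinj' : Set.InjOn (fun x : Fin (k + 1) → E => x (Fin.last k))
            (T'.filter fun x => (fun i : Fin k => x i.castSucc) = u) := by
          intro x hx y hy hxy
          simp only [Finset.coe_filter, Set.mem_ofPred_eq] at hx hy
          funext i
          refine Fin.lastCases hxy (fun i => ?_) i
          exact congrFun (hx.2.trans hy.2.symm) i
        rw [← Finset.card_image_of_injOn hinj']
        have hsub : (T'.filter fun x => (fun i : Fin k => x i.castSucc) = u).image
            (fun x : Fin (k + 1) → E => x (Fin.last k)) ⊆ ch u := by
          intro w hw
          obtain ⟨x, hx, rfl⟩ := Finset.mem_image.1 hw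
          rw [Finset.mem_filter] at hx
          have := (hmem x hx.1).2
          rwa [hx.2] at this
        split_ifs with hlast
        · exact (Finset.card_le_card hsub).trans (hchc u).le
        · rw [Finset.card_le_one]
          intro a ha b hb
          by_contra hne
          have hsep := hchs u (hsub ha) (hsub hb) hne
          have hcl : ∀ w ∈ (T'.filter fun x => (fun i : Fin k => x i.castSucc) = u).image
              (fun x : Fin (k + 1) → E => x (Fin.last k)),
              1 - ‖(inner ℂ w (v (Fin.last k)) : ℂ)‖ ≤ s := by
            intro w hw
            obtain ⟨x, hx, rfl⟩ := Finset.mem_image.1 hw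
            exact hclose x (Finset.mem_filter.1 hx).1 _ hlast
          have := one_sub_norm_inner_le (hch u a (hsub ha)).1 (hv (Fin.last k))
            (hch u b (hsub hb)).1 (hcl a ha) (hcl b hb)
          linarith
      have hcard := Finset.card_le_mul_card_image T' _ hfib
      refine hcard.trans ?_
      rw [hB, pow_add, mul_comm]
      refine Nat.mul_le_mul hT0 ?_
      split_ifs <;> simp

end Orthonormal

/-! ### Separated families of unitaries -/

/-- Gilbert–Varshamov: the neighbourhoods of a largest pairwise unrelated set cover `T`, and each
has at most `B` elements. -/
theorem exists_pairwise_not_of_card_filter_le {α : Type*} [DecidableEq α] (T : Finset α)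
    (R : α → α → Prop) [DecidableRel R] (hrefl : ∀ a ∈ T, R a a)
    (hsymm : ∀ a ∈ T, ∀ b ∈ T, R a b → R b a) (B : ℕ)
    (hB : ∀ b ∈ T, (T.filter fun a => R a b).card ≤ B) :
    ∃ t ⊆ T, ((t : Set α).Pairwise fun a b => ¬ R a b) ∧ T.card ≤ t.card * B := by
  classical
  obtain ⟨t, ht, hmax⟩ := Finset.exists_max_image
    (T.powerset.filter fun t : Finset α => (t : Set α).Pairwise fun a b => ¬ R a b) Finset.card
    ⟨∅, by simp⟩
  rw [Finset.mem_filter, Finset.mem_powerset] at ht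
  refine ⟨t, ht.1, ht.2, ?_⟩
  have hcov : T ⊆ t.biUnion fun b => T.filter fun a => R a b := by
    intro a ha
    by_contra hnot
    simp only [Finset.mem_biUnion, Finset.mem_filter, not_exists, not_and] at hnot
    have hat : a ∉ t := fun h => hnot a h ha (hrefl a ha)
    have := hmax (insert a t) (by
      rw [Finset.mem_filter, Finset.mem_powerset]
      refine ⟨Finset.insert_subset ha ht.1, ?_⟩
      rw [Finset.coe_insert]
      exact ht.2.insert fun b hb _ => ⟨hnot b hb ha, fun h =>
        hnot b hb ha (hsymm b (ht.1 hb) a ha h)⟩)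
    rw [Finset.card_insert_of_notMem hat] at this
    omega
  exact (Finset.card_le_card hcov).trans
    (Finset.card_biUnion_le_card_mul _ _ _ fun b hb => hB b (ht.1 hb))

section Unitary

variable {ι : Type*} [Fintype ι]

/-- The columns of a matrix as vectors of a Euclidean space. -/
def colVec (U : Matrix ι ι ℂ) (a : ι) : EuclideanSpace ℂ ι := WithLp.toLp 2 fun b => U b a

theorem inner_colVec (U V : Matrix ι ι ℂ) (a b : ι) :
    inner ℂ (colVec U a) (colVec V b) = (Uᴴ * V) a b := by
  simp [colVec, PiLp.inner_apply, Matrix.mul_apply, mul_comm]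

variable [DecidableEq ι]

theorem norm_colVec (U : unitaryGroup ι ℂ) (a : ι) : ‖colVec (U : Matrix ι ι ℂ) a‖ = 1 := by
  have h := inner_colVec (U : Matrix ι ι ℂ) (U : Matrix ι ι ℂ) a a
  have hU : (U : Matrix ι ι ℂ)ᴴ * (U : Matrix ι ι ℂ) = 1 := mem_unitaryGroup_iff'.1 U.2
  rw [hU, Matrix.one_apply_eq, inner_self_eq_norm_sq_to_K] at h
  have h2 : ‖colVec (U : Matrix ι ι ℂ) a‖ ^ 2 = 1 := by
    apply Complex.ofReal_injective
    push_cast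
    exact h
  nlinarith [norm_nonneg (colVec (U : Matrix ι ι ℂ) a)]

theorem exists_unitary_of_orthonormal {L : ℕ} (j : Fin L ↪ ι) {u : Fin L → EuclideanSpace ℂ ι}
    (hu : Orthonormal ℂ u) : ∃ U : unitaryGroup ι ℂ, ∀ i, colVec (U : Matrix ι ι ℂ) (j i) = u i := by
  have hex : ∃ v : ι → EuclideanSpace ℂ ι, ∀ i, v (j i) = u i :=
    ⟨Function.extend j u 0, fun i => j.injective.extend_apply _ _ _⟩
  obtain ⟨v, hv⟩ := hex
  have ho : Orthonormal ℂ ((Set.range j).domRestrict v) := by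
    rw [orthonormal_iff_ite] at hu ⊢
    rintro ⟨_, a, rfl⟩ ⟨_, b, rfl⟩
    simpa [Set.domRestrict, hv, Subtype.ext_iff, j.injective.eq_iff] using hu a b
  obtain ⟨b, hb⟩ := ho.exists_orthonormalBasis_extension_of_card_eq (by simp)
  refine ⟨⟨_, (EuclideanSpace.basisFun ι ℂ).toMatrix_orthonormalBasis_mem_unitary b⟩, fun i => ?_⟩
  rw [← hv i, ← hb _ ⟨i, rfl⟩]
  ext a
  simp [colVec, Module.Basis.toMatrix_apply]

/-- `1 - |tr (U† V)|² / d²`, a squared distance of unitaries up to a phase. -/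
def infidelity (U V : unitaryGroup ι ℂ) : ℝ :=
  1 - ‖((U : Matrix ι ι ℂ)ᴴ * (V : Matrix ι ι ℂ)).trace‖ ^ 2 / (Fintype.card ι : ℝ) ^ 2

theorem infidelity_comm (U V : unitaryGroup ι ℂ) : infidelity U V = infidelity V U := by
  unfold infidelity
  rw [← norm_star (Matrix.trace _), ← Matrix.trace_conjTranspose]
  simp

theorem infidelity_self [Nonempty ι] (U : unitaryGroup ι ℂ) : infidelity U U = 0 := by
  have hU : (U : Matrix ι ι ℂ)ᴴ * (U : Matrix ι ι ℂ) = 1 := mem_unitaryGroup_iff'.1 U.2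
  simp [infidelity, hU]

/-- With `τ = |tr U†V|`, the triangle inequality gives `τ ≤ ∑ |⟨u_a, v_a⟩|`. Since `τ ≤ d`, also `d
- τ ≤ d - τ² / d`. -/
theorem sum_one_sub_norm_inner_colVec_le [Nonempty ι] (U V : unitaryGroup ι ℂ) :
    ∑ a, (1 - ‖(inner ℂ (colVec (U : Matrix ι ι ℂ) a) (colVec (V : Matrix ι ι ℂ) a) : ℂ)‖) ≤
      Fintype.card ι * infidelity U V := by
  set d : ℝ := (Fintype.card ι : ℝ) with hd
  have hdpos : 0 < d := by simp [hd, Fintype.card_pos]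
  have hle1 : ∀ a, ‖(inner ℂ (colVec (U : Matrix ι ι ℂ) a) (colVec (V : Matrix ι ι ℂ) a) : ℂ)‖
      ≤ 1 := fun a => by
    have := norm_inner_le_norm (𝕜 := ℂ) (colVec (U : Matrix ι ι ℂ) a) (colVec (V : Matrix ι ι ℂ) a)
    rwa [norm_colVec, norm_colVec, one_mul] at this
  set S := ∑ a, ‖(inner ℂ (colVec (U : Matrix ι ι ℂ) a) (colVec (V : Matrix ι ι ℂ) a) : ℂ)‖ with hS
  have hSd : S ≤ d := by
    have := Finset.sum_le_sum fun a (_ : a ∈ Finset.univ) => hle1 a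
    simpa [hS, hd] using this
  have htr : ‖((U : Matrix ι ι ℂ)ᴴ * (V : Matrix ι ι ℂ)).trace‖ ≤ S := by
    rw [Matrix.trace]
    refine (norm_sum_le _ _).trans (le_of_eq ?_)
    exact Finset.sum_congr rfl fun a _ => by rw [inner_colVec]; rfl
  rw [Finset.sum_sub_distrib]
  simp only [Finset.sum_const, Finset.card_univ, nsmul_eq_mul, mul_one]
  rw [← hS, ← hd, infidelity, ← hd]
  set τ := ‖((U : Matrix ι ι ℂ)ᴴ * (V : Matrix ι ι ℂ)).trace‖ with hτ
  have hτ0 : 0 ≤ τ := norm_nonneg _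
  have h1 : d * (1 - τ ^ 2 / d ^ 2) = d - τ ^ 2 / d := by field_simp
  rw [h1]
  have h2 : τ ^ 2 / d ≤ τ := by
    rw [div_le_iff₀ hdpos]
    nlinarith
  linarith

/-- The unitary group contains exponentially (in the square of the dimension) many unitaries that
are pairwise well separated. -/
theorem exists_separated_unitaries {L : ℕ} (hL : 1 ≤ L) (hcard : Fintype.card ι = 2 * L) {x : ℝ}
    (hx : 0 < x) (hx1 : x ≤ 1 / 320) :
    ∃ t : Finset (unitaryGroup ι ℂ),
      ((t : Set (unitaryGroup ι ℂ)).Pairwise fun U V => 3 / 2 * x ^ 2 < infidelity U V) ∧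
      0 < t.card ∧ (L : ℝ) ^ 2 * Real.log (1 / (20 * x)) ≤ Real.log t.card := by
  classical
  have hι : Nonempty ι := Fintype.card_pos_iff.1 (by omega)
  have hj : Nonempty (Fin L ↪ ι) := Function.Embedding.nonempty_of_card_le (by simp; omega)
  obtain ⟨j⟩ := hj
  set r := 20 * x with hr
  set y : ℝ := (1 / r) ^ (2 * L) with hy
  set q := ⌊y⌋₊ with hq
  have hr0 : 0 < r := by positivity
  have h16 : 16 ≤ 1 / r := by
    rw [le_div_iff₀ hr0]; linarith
  have hy0 : 0 < y := by positivity
  have hy16 : 16 ≤ y := h16.trans (le_self_pow₀ (by linarith) (by omega))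
  have hqy : (q : ℝ) ≤ y := Nat.floor_le hy0.le
  have hq2 : y / 2 ≤ q := by
    have := Nat.lt_floor_add_one y
    rw [← hq] at this
    linarith
  have hq1 : 1 ≤ q := by
    have : (1 : ℝ) ≤ q := by linarith
    exact_mod_cast this
  -- Only `L` of the `2 L` columns are prescribed, so every choice still has `L` free complex
  -- dimensions. The constants fit because `4 · 12 x² = 48 x² ≤ 50 x² = r² / 8`.
  obtain ⟨T, hTc, hTo, hT⟩ := exists_orthonormal_tree (E := EuclideanSpace ℂ ι) (L := L)
    (s := 12 * x ^ 2) hr0 (by linarith) (by rw [hr]; nlinarith [sq_nonneg x]) hqy L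
    (by rw [finrank_euclideanSpace, hcard]; omega)
  have hU : ∀ u : Fin L → EuclideanSpace ℂ ι, ∃ U : unitaryGroup ι ℂ,
      u ∈ T → ∀ i, colVec (U : Matrix ι ι ℂ) (j i) = u i := by
    intro u
    by_cases hu : u ∈ T
    · obtain ⟨U, hU⟩ := exists_unitary_of_orthonormal j (hTo u hu)
      exact ⟨U, fun _ => hU⟩
    · exact ⟨1, fun h => absurd h hu⟩
  choose W hW using hU
  let R : (Fin L → EuclideanSpace ℂ ι) → (Fin L → EuclideanSpace ℂ ι) → Prop :=
    fun u v => infidelity (W u) (W v) ≤ 3 / 2 * x ^ 2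
  have hRrefl : ∀ u ∈ T, R u u := fun u _ => by
    simp only [R, infidelity_self]; positivity
  have hcount : ∀ v ∈ T, (T.filter fun u => R u v).card ≤ 2 ^ L * q ^ (L / 4) := by
    intro v hv
    let F : Finset (Fin L) → Finset (Fin L → EuclideanSpace ℂ ι) := fun B =>
      T.filter fun u => ∀ i ∉ B, 1 - ‖(inner ℂ (u i) (v i) : ℂ)‖ ≤ 12 * x ^ 2
    have hsub : (T.filter fun u => R u v) ⊆
        (Finset.univ.filter fun B : Finset (Fin L) => 4 * B.card ≤ L).biUnion F := by
      intro u hu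
      rw [Finset.mem_filter] at hu
      obtain ⟨huT, huR⟩ := hu
      -- The total deficit is at most `2L · (3/2) x² = 3 L x²`, while each bad column contributes
      -- more than `12 x²`. By Markov at most a quarter of the columns are bad. Summing over the at
      -- most `2 ^ L` sets `B` bounds the neighbourhood.
      let B : Finset (Fin L) :=
        Finset.univ.filter fun i => 12 * x ^ 2 < 1 - ‖(inner ℂ (u i) (v i) : ℂ)‖
      have hnn : ∀ a, 0 ≤ 1 - ‖(inner ℂ (colVec (W u : Matrix ι ι ℂ) a)
          (colVec (W v : Matrix ι ι ℂ) a) : ℂ)‖ := fun a => by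
        have := norm_inner_le_norm (𝕜 := ℂ) (colVec (W u : Matrix ι ι ℂ) a)
          (colVec (W v : Matrix ι ι ℂ) a)
        rw [norm_colVec, norm_colVec, one_mul] at this
        linarith
      have h1 : ∑ i ∈ B, (1 - ‖(inner ℂ (u i) (v i) : ℂ)‖) ≤ 2 * L * (3 / 2 * x ^ 2) := by
        have h2 := sum_one_sub_norm_inner_colVec_le (W u) (W v)
        rw [hcard] at h2
        push_cast at h2
        calc ∑ i ∈ B, (1 - ‖(inner ℂ (u i) (v i) : ℂ)‖)
            = ∑ a ∈ B.map j, (1 - ‖(inner ℂ (colVec (W u : Matrix ι ι ℂ) a)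
                (colVec (W v : Matrix ι ι ℂ) a) : ℂ)‖) := by
              rw [Finset.sum_map]
              exact Finset.sum_congr rfl fun i _ => by rw [hW u huT, hW v hv]
          _ ≤ ∑ a, (1 - ‖(inner ℂ (colVec (W u : Matrix ι ι ℂ) a)
                (colVec (W v : Matrix ι ι ℂ) a) : ℂ)‖) :=
              Finset.sum_le_sum_of_subset_of_nonneg (Finset.subset_univ _) fun a _ _ => hnn a
          _ ≤ _ := h2.trans (mul_le_mul_of_nonneg_left huR (by positivity))
      have h3 : (B.card : ℝ) * (12 * x ^ 2) ≤ ∑ i ∈ B, (1 - ‖(inner ℂ (u i) (v i) : ℂ)‖) := by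
        rw [← nsmul_eq_mul]
        exact Finset.card_nsmul_le_sum _ _ _ fun i hi => (Finset.mem_filter.1 hi).2.le
      have h4 : (4 * B.card : ℝ) ≤ L := by
        have : (4 * B.card : ℝ) * (3 * x ^ 2) ≤ L * (3 * x ^ 2) := by linarith
        exact le_of_mul_le_mul_right this (by positivity)
      rw [Finset.mem_biUnion]
      refine ⟨B, by simpa using (by exact_mod_cast h4 : 4 * B.card ≤ L), ?_⟩
      simp only [F, Finset.mem_filter]
      refine ⟨huT, fun i hi => ?_⟩
      simpa [B] using hi
    refine (Finset.card_le_card hsub).trans ?_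
    have hv1 : ∀ i, ‖v i‖ = 1 := (hTo v hv).1
    refine (Finset.card_biUnion_le_card_mul _ _ (q ^ (L / 4)) fun B hB => ?_).trans ?_
    · refine (hT v hv1 B _ (Finset.filter_subset _ _) fun u hu => (Finset.mem_filter.1 hu).2).trans
        (Nat.pow_le_pow_right hq1 ?_)
      have : 4 * B.card ≤ L := (Finset.mem_filter.1 hB).2
      omega
    · refine Nat.mul_le_mul_right _ ((Finset.card_filter_le _ _).trans ?_)
      simp
  obtain ⟨t, htT, hsep, ht⟩ := exists_pairwise_not_of_card_filter_le T R hRrefl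
    (fun u _ v _ h => by simpa only [R, infidelity_comm] using h) _ hcount
  have hinj : Set.InjOn W t := by
    intro u hu v hv huv
    by_contra hne
    refine hsep hu hv hne ?_
    simp only [R, huv, infidelity_self]
    positivity
  rw [hTc] at ht
  have htpos : 0 < t.card := by
    rcases Nat.eq_zero_or_pos t.card with h | h
    · rw [h, zero_mul] at ht
      have := Nat.one_le_pow L q hq1
      omega
    · exact h
  have hci : (t.image W).card = t.card := Finset.card_image_of_injOn hinj
  refine ⟨t.image W, ?_, by rwa [hci], ?_⟩
  · intro a ha b hb hab
    rw [Finset.mem_coe, Finset.mem_image] at ha hb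
    obtain ⟨u, hu, rfl⟩ := ha
    obtain ⟨v, hv, rfl⟩ := hb
    exact not_le.1 (hsep hu hv fun h => hab (by rw [h]))
  · rw [hci]
    have ht' : (q : ℝ) ^ L ≤ t.card * (2 ^ L * (q : ℝ) ^ (L / 4)) := by exact_mod_cast ht
    have hqpos : (0 : ℝ) < q := by exact_mod_cast hq1
    have htp : (0 : ℝ) < t.card := by exact_mod_cast htpos
    have hlog := Real.log_le_log (by positivity) ht'
    rw [Real.log_mul htp.ne' (by positivity), Real.log_mul (by positivity) (by positivity),
      Real.log_pow, Real.log_pow, Real.log_pow] at hlog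
    have hlq : 2 * L * Real.log (1 / r) - Real.log 2 ≤ Real.log q := by
      have := Real.log_le_log (by positivity) hq2
      rw [Real.log_div hy0.ne' (by norm_num), hy, Real.log_pow] at this
      push_cast at this
      linarith
    have hl16 : 4 * Real.log 2 ≤ Real.log (1 / r) := by
      have := Real.log_le_log (by norm_num) h16
      rw [show (16 : ℝ) = 2 ^ 4 by norm_num, Real.log_pow] at this
      push_cast at this
      exact this
    have hL4 : ((L / 4 : ℕ) : ℝ) ≤ L / 4 := Nat.cast_div_le
    have hq0 : 0 ≤ Real.log q := Real.log_natCast_nonneg q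
    have hL1 : (1 : ℝ) ≤ L := by exact_mod_cast hL
    have hl2 : 0 < Real.log 2 := Real.log_pos (by norm_num)
    have h1 : ((L / 4 : ℕ) : ℝ) * Real.log q ≤ L / 4 * Real.log q :=
      mul_le_mul_of_nonneg_right hL4 hq0
    have h2 : (L : ℝ) * (3 / 4 * Real.log q - Real.log 2) ≤ Real.log t.card := by linarith
    refine le_trans ?_ h2
    -- From `log q ≥ 2L log (1/r) - log 2`, the right side is at least `(3/2) L log (1/r) - (7/4)
    -- log 2`. The loss is absorbed since `4 log 2 ≤ log (1/r)` and `L ≥ 1`.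
    have h3 : (L : ℝ) * Real.log (1 / r) ≤ 3 / 4 * Real.log q - Real.log 2 := by
      nlinarith
    calc (L : ℝ) ^ 2 * Real.log (1 / r) = L * (L * Real.log (1 / r)) := by ring
      _ ≤ _ := mul_le_mul_of_nonneg_left h3 (by positivity)

end Unitary

/-! ### Pure states -/

section Pure

theorem rank_add_le_add_rank {ι : Type*} [Fintype ι] (A B : Matrix ι ι ℂ) :
    (A + B).rank ≤ A.rank + B.rank := by
  rw [Matrix.rank, Matrix.rank, Matrix.rank, Matrix.mulVecLin_add]
  exact (Submodule.finrank_mono (LinearMap.range_add_le _ _)).trans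
    (Submodule.finrank_add_le_finrank_add_finrank _ _)

theorem half_sum_eigenvalues_sq_le_traceDist_sq {ι : Type*} [Fintype ι] [DecidableEq ι]
    (ρ σ : DensityMatrix ι) :
    (1 / 2) * ∑ i, (ρ.2.1.isHermitian.sub σ.2.1.isHermitian).eigenvalues i ^ 2 ≤
      traceDist ρ σ ^ 2 := by
  have h := two_mul_sum_eigenvalues_sq_le (ρ.2.1.isHermitian.sub σ.2.1.isHermitian)
    (by rw [Matrix.trace_sub, ρ.2.2, σ.2.2, sub_self])
  unfold traceDist
  rw [mul_pow]
  linarith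

theorem traceDist_sq_le_of_rank_le_two {ι : Type*} [Fintype ι] [DecidableEq ι]
    {ρ σ : DensityMatrix ι} (h2 : (ρ.1 - σ.1).rank ≤ 2) :
    traceDist ρ σ ^ 2 ≤
      (1 / 2) * ∑ i, (ρ.2.1.isHermitian.sub σ.2.1.isHermitian).eigenvalues i ^ 2 := by
  have h := sum_abs_eigenvalues_sq_le_rank (ρ.2.1.isHermitian.sub σ.2.1.isHermitian)
  have h2' : ((ρ.1 - σ.1).rank : ℝ) ≤ 2 := by exact_mod_cast h2
  have h3 := mul_le_mul_of_nonneg_right h2' (Finset.sum_nonneg fun i (_ : i ∈ Finset.univ) =>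
    sq_nonneg ((ρ.2.1.isHermitian.sub σ.2.1.isHermitian).eigenvalues i))
  unfold traceDist
  rw [mul_pow]
  linarith

variable {n : ℕ}

theorem conjState_mul {ι : Type*} [Fintype ι] [DecidableEq ι] (U V : unitaryGroup ι ℂ)
    (ρ : DensityMatrix ι) : conjState U (conjState V ρ) = conjState (U * V) ρ := by
  apply Subtype.ext
  simp [conjState, Matrix.mul_assoc, Matrix.conjTranspose_mul]

theorem zeroState_mul_mul_zeroState (A : Matrix (Qubits n) (Qubits n) ℂ) :
    (zeroState n).1 * A * (zeroState n).1 = A 0 0 • (zeroState n).1 := by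
  ext a b
  simp only [zeroState, Matrix.mul_diagonal, Matrix.diagonal_mul, Matrix.smul_apply,
    Matrix.diagonal_apply, smul_eq_mul]
  by_cases ha : a = 0 <;> by_cases hb : b = 0
  · simp [ha, hb]
  · subst ha
    simp [hb, Ne.symm hb]
  · subst hb
    simp [ha]
  · simp [ha, hb]

theorem trace_conjState_mul_conjState (U V : QubitUnitary n) :
    ((conjState U (zeroState n)).1 * (conjState V (zeroState n)).1).trace =
      (‖((U : Matrix (Qubits n) (Qubits n) ℂ)ᴴ * (V : Matrix (Qubits n) (Qubits n) ℂ)) 0 0‖ ^ 2 : ℂ) := by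
  set A : Matrix (Qubits n) (Qubits n) ℂ := (U : Matrix (Qubits n) (Qubits n) ℂ)
  set B : Matrix (Qubits n) (Qubits n) ℂ := (V : Matrix (Qubits n) (Qubits n) ℂ)
  have h1 : (conjState U (zeroState n)).1 * (conjState V (zeroState n)).1 =
      A * (((zeroState n).1 * (Aᴴ * B) * (zeroState n).1) * Bᴴ) := by
    simp [conjState, Matrix.mul_assoc, A, B]
  have h2 : (zeroState n).1 * (Bᴴ * A) * (zeroState n).1 = (Bᴴ * A) 0 0 • (zeroState n).1 :=
    zeroState_mul_mul_zeroState _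
  have hid : (zeroState n).1 * (zeroState n).1 = (zeroState n).1 := by
    simpa using zeroState_mul_mul_zeroState (n := n) 1
  have h3 : ((zeroState n).1 * (Bᴴ * A)).trace = (Bᴴ * A) 0 0 := by
    have := congrArg Matrix.trace h2
    rw [Matrix.trace_mul_comm, ← Matrix.mul_assoc, hid, Matrix.trace_smul, (zeroState n).2.2] at this
    simpa using this
  rw [h1, zeroState_mul_mul_zeroState, Matrix.trace_mul_comm, Matrix.smul_mul, Matrix.smul_mul,
    Matrix.trace_smul, Matrix.mul_assoc, h3, smul_eq_mul, ← Complex.mul_conj']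
  congr 1
  rw [← Matrix.conjTranspose_conjTranspose (Bᴴ * A), Matrix.conjTranspose_mul,
    Matrix.conjTranspose_conjTranspose, Matrix.conjTranspose_apply]
  rfl

theorem conjState_zeroState_eq_vecMulVec (U : QubitUnitary n) :
    (conjState U (zeroState n)).1 = vecMulVec (fun a => (U : Matrix (Qubits n) (Qubits n) ℂ) a 0)
      (fun a => star ((U : Matrix (Qubits n) (Qubits n) ℂ) a 0)) := by
  ext a b
  simp only [conjState]
  rw [Matrix.mul_apply, vecMulVec_apply]
  simp only [zeroState, Matrix.mul_diagonal, Matrix.conjTranspose_apply]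
  rw [Finset.sum_eq_single 0]
  · simp
  · intro c _ hc
    simp [hc]
  · simp

/-- The trace distance of two pure states. -/
theorem traceDist_conjState_zeroState_sq (U V : QubitUnitary n) :
    traceDist (conjState U (zeroState n)) (conjState V (zeroState n)) ^ 2 =
      1 - ‖((U : Matrix (Qubits n) (Qubits n) ℂ)ᴴ * (V : Matrix (Qubits n) (Qubits n) ℂ)) 0 0‖ ^ 2 := by
  have hU : (U : Matrix (Qubits n) (Qubits n) ℂ)ᴴ * (U : Matrix (Qubits n) (Qubits n) ℂ) = 1 :=
    mem_unitaryGroup_iff'.1 U.2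
  have hV : (V : Matrix (Qubits n) (Qubits n) ℂ)ᴴ * (V : Matrix (Qubits n) (Qubits n) ℂ) = 1 :=
    mem_unitaryGroup_iff'.1 V.2
  have hrank : ((conjState U (zeroState n)).1 - (conjState V (zeroState n)).1).rank ≤ 2 := by
    rw [conjState_zeroState_eq_vecMulVec, conjState_zeroState_eq_vecMulVec, sub_eq_add_neg,
      ← neg_vecMulVec]
    refine (rank_add_le_add_rank _ _).trans ?_
    have h1 := rank_vecMulVec_le (fun a => (U : Matrix (Qubits n) (Qubits n) ℂ) a 0)
      (fun a => star ((U : Matrix (Qubits n) (Qubits n) ℂ) a 0))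
    have h2 := rank_vecMulVec_le (-fun a => (V : Matrix (Qubits n) (Qubits n) ℂ) a 0)
      (fun a => star ((V : Matrix (Qubits n) (Qubits n) ℂ) a 0))
    omega
  -- Rank at most two and trace zero give opposite inequalities, so the squared distance is exactly
  -- `½ tr (ρ - σ)²`.
  rw [le_antisymm (traceDist_sq_le_of_rank_le_two hrank)
    (half_sum_eigenvalues_sq_le_traceDist_sq _ _)]
  apply Complex.ofReal_injective
  rw [Complex.ofReal_mul, sum_eigenvalues_sq, Matrix.sub_mul, Matrix.mul_sub, Matrix.mul_sub,
    Matrix.trace_sub, Matrix.trace_sub, Matrix.trace_sub,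
    Matrix.trace_mul_comm (conjState V (zeroState n)).1 (conjState U (zeroState n)).1,
    trace_conjState_mul_conjState, trace_conjState_mul_conjState, trace_conjState_mul_conjState,
    hU, hV]
  simp
  ring

/-- With overlap `c` of modulus at most one, `1 - |c|² ≤ 2 (1 - |c|) ≤ 2 (1 - Re c)`. State vectors
thus transfer Euclidean volume bounds to trace distance. -/
theorem traceDist_conjState_zeroState_le (U V : QubitUnitary n) :
    traceDist (conjState U (zeroState n)) (conjState V (zeroState n)) ≤
      dist (colVec (U : Matrix (Qubits n) (Qubits n) ℂ) 0)
        (colVec (V : Matrix (Qubits n) (Qubits n) ℂ) 0) := by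
  refine abs_le_of_sq_le_sq' ?_ dist_nonneg |>.2
  rw [traceDist_conjState_zeroState_sq, ← inner_colVec, dist_eq_norm]
  have h := norm_sub_sq (𝕜 := ℂ) (colVec (U : Matrix (Qubits n) (Qubits n) ℂ) 0)
    (colVec (V : Matrix (Qubits n) (Qubits n) ℂ) 0)
  rw [norm_colVec, norm_colVec] at h
  rw [h]
  have h1 := RCLike.re_le_norm (inner ℂ (colVec (U : Matrix (Qubits n) (Qubits n) ℂ) 0)
    (colVec (V : Matrix (Qubits n) (Qubits n) ℂ) 0) : ℂ)
  nlinarith [sq_nonneg (1 - ‖(inner ℂ (colVec (U : Matrix (Qubits n) (Qubits n) ℂ) 0)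
    (colVec (V : Matrix (Qubits n) (Qubits n) ℂ) 0) : ℂ)‖)]

theorem coveringNumber_le_of_forall_separated {X : Type*} {K : Set X} {d : X → X → ℝ} {r : ℝ}
    {B : ℕ} (hself : ∀ x, d x x ≤ r) (hcomm : ∀ x y, d x y = d y x)
    (h : ∀ t : Finset X, (t : Set X) ⊆ K → ((t : Set X).Pairwise fun x y => r < d x y) →
      t.card ≤ B) : coveringNumber K d r ≤ B := by
  classical
  let T : Set ℕ := {m | ∃ t : Finset X, ((t : Set X) ⊆ K ∧
    ((t : Set X).Pairwise fun x y => r < d x y)) ∧ t.card = m}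
  have hne : T.Nonempty := ⟨0, ∅, by simp, rfl⟩
  have hbdd : BddAbove T := by
    refine ⟨B, ?_⟩
    rintro _ ⟨t, ⟨ht, hsep⟩, rfl⟩
    exact h t ht hsep
  obtain ⟨t, ⟨ht, hsep⟩, hcard⟩ := Nat.sSup_mem hne hbdd
  have hle : coveringNumber K d r ≤ (t : Set X).encard := by
    refine iInf₂_le_of_le (t : Set X) ht (iInf_le_of_le (fun y hy => ?_) le_rfl)
    by_contra hnot
    push Not at hnot
    have hyt : y ∉ t := fun h => (hself y).not_gt (hnot y h)
    have hmem : (insert y t).card ∈ T := by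
      refine ⟨insert y t, ⟨?_, ?_⟩, rfl⟩
      · rw [Finset.coe_insert]
        exact Set.insert_subset hy ht
      · rw [Finset.coe_insert]
        refine hsep.insert fun x hx _ => ⟨hnot x hx, ?_⟩
        rw [hcomm]
        exact hnot x hx
    have := le_csSup hbdd hmem
    rw [Finset.card_insert_of_notMem hyt, ← hcard] at this
    omega
  refine hle.trans ?_
  rw [Set.encard_coe_eq_coe_finsetCard]
  exact_mod_cast h t ht hsep

/-- Pure states on `n` qubits can be covered by `(1 + 2 / η) ^ (2 * 2 ^ n)` balls. -/
theorem coveringNumber_pure_le {K : Set (DensityMatrix (Qubits n))} {η : ℝ} (hη : 0 < η)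
    (hK : K ⊆ Set.range fun U : QubitUnitary n => conjState U (zeroState n)) :
    coveringNumber K traceDist η ≤ (⌊(1 + 2 / η) ^ (2 * 2 ^ n)⌋₊ : ℕ) := by
  classical
  refine coveringNumber_le_of_forall_separated (fun ρ => by rw [traceDist_self]; exact hη.le)
    traceDist_comm fun t ht hsep => ?_
  have hrep : ∀ σ : t, ∃ U : QubitUnitary n, conjState U (zeroState n) = σ := fun σ => hK (ht σ.2)
  choose U hU using hrep
  let ψ : t → EuclideanSpace ℂ (Qubits n) := fun σ => colVec (U σ : Matrix _ _ ℂ) 0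
  have hψ : ∀ σ τ : t, σ ≠ τ → η < dist (ψ σ) (ψ τ) := fun σ τ hne => by
    refine lt_of_lt_of_le ?_ (traceDist_conjState_zeroState_le (U σ) (U τ))
    rw [hU, hU]
    exact hsep σ.2 τ.2 fun h => hne (Subtype.ext h)
  have hinj : Function.Injective ψ := fun σ τ h => by
    by_contra hne
    have := hψ σ τ hne
    rw [h, dist_self] at this
    exact lt_asymm this hη
  have h := card_le_of_separated_closedBall hη (Finset.univ.image ψ)
    (by
      intro x hx
      obtain ⟨σ, -, rfl⟩ := Finset.mem_image.1 hx
      exact (norm_colVec _ _).le)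
    (by
      intro a ha b hb hab
      rw [Finset.mem_coe, Finset.mem_image] at ha hb
      obtain ⟨σ, -, rfl⟩ := ha
      obtain ⟨τ, -, rfl⟩ := hb
      exact hψ σ τ fun h => hab (by rw [h]))
  rw [Finset.card_image_of_injective _ hinj, Finset.card_univ, Fintype.card_coe,
    finrank_real_of_complex, finrank_euclideanSpace] at h
  refine Nat.le_floor ?_
  simpa using h

/-! ### Topology of the unitary group -/

theorem isCompact_unitaryGroup (ι : Type*) [Fintype ι] [DecidableEq ι] :
    IsCompact (unitaryGroup ι ℂ : Set (Matrix ι ι ℂ)) := by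
  have hc : IsCompact (Set.pi Set.univ fun _ : ι => Set.pi Set.univ fun _ : ι =>
      Metric.closedBall (0 : ℂ) 1) :=
    isCompact_univ_pi fun _ => isCompact_univ_pi fun _ => isCompact_closedBall _ _
  have hcl : IsClosed (unitaryGroup ι ℂ : Set (Matrix ι ι ℂ)) := by
    have : (unitaryGroup ι ℂ : Set (Matrix ι ι ℂ)) = {A | A * star A = 1} := by
      ext A
      exact mem_unitaryGroup_iff
    rw [this]
    exact isClosed_eq (continuous_id.matrix_mul continuous_id.star) continuous_const
  refine IsCompact.of_isClosed_subset hc hcl fun A hA i _ j _ => ?_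
  rw [mem_closedBall_zero_iff]
  exact entry_norm_bound_of_unitary hA i j

instance compactSpace_unitaryGroup (ι : Type*) [Fintype ι] [DecidableEq ι] :
    CompactSpace (unitaryGroup ι ℂ) :=
  isCompact_iff_compactSpace.1 (isCompact_unitaryGroup ι)

theorem continuous_conjState_left {ι : Type*} [Fintype ι] [DecidableEq ι] (ρ : DensityMatrix ι) :
    Continuous fun U : unitaryGroup ι ℂ => conjState U ρ :=
  Continuous.subtype_mk ((continuous_subtype_val.matrix_mul continuous_const).matrix_mul
    continuous_subtype_val.matrix_conjTranspose) _

theorem continuous_conjState_right {ι : Type*} [Fintype ι] [DecidableEq ι]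
    (U : unitaryGroup ι ℂ) : Continuous (conjState U) :=
  Continuous.subtype_mk ((continuous_const.matrix_mul continuous_subtype_val).matrix_mul
    continuous_const) _

/-- The orbit of a state under the compact unitary group is closed and carries full measure. -/
theorem support_map_conjState_subset (ν : Measure (QubitUnitary n)) :
    (ν.map fun U => conjState U (zeroState n)).support ⊆
      Set.range fun U : QubitUnitary n => conjState U (zeroState n) := by
  have hc : Continuous fun U : QubitUnitary n => conjState U (zeroState n) :=
    continuous_conjState_left _
  have hcl : IsClosed (Set.range fun U : QubitUnitary n => conjState U (zeroState n)) :=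
    (isCompact_range hc).isClosed
  refine Measure.support_subset_of_isClosed hcl ?_
  rw [mem_ae_map_iff hc.measurable.aemeasurable hcl.measurableSet]
  exact Filter.univ_mem' fun U => ⟨U, rfl⟩

end Pure

/-! ### Averages over products of single-qubit stabilizer states -/

section Stabilizer

/-- The amplitudes of the six single-qubit stabilizer states. -/
def stab : Fin 6 → Fin 2 → ℂ :=
  ![![1, 0], ![0, 1], ![(√2)⁻¹, (√2)⁻¹], ![(√2)⁻¹, -(√2)⁻¹],
    ![(√2)⁻¹, (√2)⁻¹ * Complex.I], ![(√2)⁻¹, -((√2)⁻¹ * Complex.I)]]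

theorem inv_sqrt_two_mul_self : ((√2 : ℝ) : ℂ)⁻¹ * ((√2 : ℝ) : ℂ)⁻¹ = 1 / 2 := by
  rw [← mul_inv, ← Complex.ofReal_mul, Real.mul_self_sqrt (by norm_num)]
  norm_num

theorem stab_norm (s : Fin 6) :
    stab s 0 * star (stab s 0) + stab s 1 * star (stab s 1) = 1 := by
  have h := inv_sqrt_two_mul_self
  fin_cases s
  · simp [stab]
  · simp [stab]
  · simp [stab]
    linear_combination 2 * h
  · simp [stab]
    linear_combination 2 * h
  · simp [stab]
    linear_combination 2 * h - ((√2 : ℝ) : ℂ)⁻¹ * ((√2 : ℝ) : ℂ)⁻¹ * Complex.I_sq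
  · simp [stab]
    linear_combination 2 * h - ((√2 : ℝ) : ℂ)⁻¹ * ((√2 : ℝ) : ℂ)⁻¹ * Complex.I_sq

/-- A single-qubit unitary that prepares a stabilizer state. -/
def stabUnitary (s : Fin 6) : unitaryGroup (Fin 2) ℂ :=
  ⟨!![stab s 0, -star (stab s 1); stab s 1, star (stab s 0)], by
    rw [mem_unitaryGroup_iff']
    have h := stab_norm s
    ext i j
    fin_cases i <;> fin_cases j <;>
      simp [Matrix.mul_apply, Fin.sum_univ_two, Matrix.star_apply] at h ⊢
    · linear_combination h
    · ring
    · ring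
    · linear_combination h⟩

theorem stabUnitary_apply_zero (s : Fin 6) (a : Fin 2) :
    (stabUnitary s : Matrix (Fin 2) (Fin 2) ℂ) a 0 = stab s a := by
  fin_cases a <;> simp [stabUnitary]

/-- The stabilizer states form a 2-design. -/
theorem sum_stab_sq (Z : Fin 2 → Fin 2 → ℂ) :
    ∑ s, ‖∑ a, ∑ b, star (stab s a) * Z a b * stab s b‖ ^ 2 =
      ‖Z 0 0 + Z 1 1‖ ^ 2 + ∑ a, ∑ b, ‖Z a b‖ ^ 2 := by
  have h := inv_sqrt_two_mul_self
  have e0 : ∑ a, ∑ b, star (stab 0 a) * Z a b * stab 0 b = Z 0 0 := by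
    simp [Fin.sum_univ_two, stab]
  have e1 : ∑ a, ∑ b, star (stab 1 a) * Z a b * stab 1 b = Z 1 1 := by
    simp [Fin.sum_univ_two, stab]
  have e2 : ∑ a, ∑ b, star (stab 2 a) * Z a b * stab 2 b =
      1 / 2 * (Z 0 0 + Z 1 1 + (Z 0 1 + Z 1 0)) := by
    simp [Fin.sum_univ_two, stab]
    linear_combination (Z 0 0 + Z 1 1 + (Z 0 1 + Z 1 0)) * h
  have e3 : ∑ a, ∑ b, star (stab 3 a) * Z a b * stab 3 b =
      1 / 2 * (Z 0 0 + Z 1 1 - (Z 0 1 + Z 1 0)) := by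
    simp [Fin.sum_univ_two, stab]
    linear_combination (Z 0 0 + Z 1 1 - (Z 0 1 + Z 1 0)) * h
  have e4 : ∑ a, ∑ b, star (stab 4 a) * Z a b * stab 4 b =
      1 / 2 * (Z 0 0 + Z 1 1 + Complex.I * (Z 0 1 - Z 1 0)) := by
    simp [Fin.sum_univ_two, stab]
    linear_combination (Z 0 0 + Z 1 1 + Complex.I * (Z 0 1 - Z 1 0)) * h -
      ((√2 : ℝ) : ℂ)⁻¹ * ((√2 : ℝ) : ℂ)⁻¹ * Z 1 1 * Complex.I_sq
  have e5 : ∑ a, ∑ b, star (stab 5 a) * Z a b * stab 5 b =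
      1 / 2 * (Z 0 0 + Z 1 1 - Complex.I * (Z 0 1 - Z 1 0)) := by
    simp [Fin.sum_univ_two, stab]
    linear_combination (Z 0 0 + Z 1 1 - Complex.I * (Z 0 1 - Z 1 0)) * h -
      ((√2 : ℝ) : ℂ)⁻¹ * ((√2 : ℝ) : ℂ)⁻¹ * Z 1 1 * Complex.I_sq
  rw [Fin.sum_univ_six, e0, e1, e2, e3, e4, e5]
  simp only [Fin.sum_univ_two, Complex.sq_norm, Complex.normSq_apply]
  simp
  ring

variable {n : ℕ}

/-- The expectation of `Y` in a product of stabilizer states. -/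
def stabExpect (Y : Matrix (Qubits n) (Qubits n) ℂ) (s : Fin n → Fin 6) : ℂ :=
  ∑ x, ∑ y, star (∏ i, stab (s i) (x i)) * Y x y * ∏ i, stab (s i) (y i)

theorem sum_fin_cons {α M : Type*} [Fintype α] [AddCommMonoid M] (F : (Fin (n + 1) → α) → M) :
    ∑ x, F x = ∑ a, ∑ x : Fin n → α, F (Fin.cons a x) := by
  rw [← Fintype.sum_prod_type']
  exact (Fintype.sum_equiv (Fin.consEquiv fun _ => α) _ _ fun _ => rfl).symm

/-- The blocks of a matrix with respect to the first qubit. -/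
def qubitBlock (Y : Matrix (Qubits (n + 1)) (Qubits (n + 1)) ℂ) (a b : Fin 2) :
    Matrix (Qubits n) (Qubits n) ℂ :=
  Matrix.of fun x y => Y (Fin.cons a x) (Fin.cons b y)

theorem stabExpect_cons (Y : Matrix (Qubits (n + 1)) (Qubits (n + 1)) ℂ) (s0 : Fin 6)
    (s : Fin n → Fin 6) : stabExpect Y (Fin.cons s0 s) =
      ∑ a, ∑ b, star (stab s0 a) * stabExpect (qubitBlock Y a b) s * stab s0 b := by
  unfold stabExpect
  rw [sum_fin_cons]
  refine Finset.sum_congr rfl fun a _ => ?_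
  simp_rw [sum_fin_cons (M := ℂ)]
  rw [Finset.sum_comm]
  refine Finset.sum_congr rfl fun b _ => ?_
  rw [Finset.mul_sum, Finset.sum_mul]
  refine Finset.sum_congr rfl fun x _ => ?_
  rw [Finset.mul_sum, Finset.sum_mul]
  refine Finset.sum_congr rfl fun y _ => ?_
  simp only [Fin.prod_univ_succ, Fin.cons_zero, Fin.cons_succ, qubitBlock, Matrix.of_apply,
    star_mul']
  ring

theorem stabExpect_add (Y Z : Matrix (Qubits n) (Qubits n) ℂ) (s : Fin n → Fin 6) :
    stabExpect (Y + Z) s = stabExpect Y s + stabExpect Z s := by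
  simp only [stabExpect, ← Finset.sum_add_distrib, Matrix.add_apply]
  refine Finset.sum_congr rfl fun x _ => Finset.sum_congr rfl fun y _ => ?_
  ring

/-- The squared Frobenius norm. -/
def frobSq {ι : Type*} [Fintype ι] (A : Matrix ι ι ℂ) : ℝ := ∑ x, ∑ y, ‖A x y‖ ^ 2

theorem frobSq_add_add_frobSq_sub {ι : Type*} [Fintype ι] (A B : Matrix ι ι ℂ) :
    frobSq (A + B) + frobSq (A - B) = 2 * (frobSq A + frobSq B) := by
  simp only [frobSq, ← Finset.sum_add_distrib, Finset.mul_sum]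
  refine Finset.sum_congr rfl fun x _ => Finset.sum_congr rfl fun y _ => ?_
  have := parallelogram_law_with_norm ℂ (A x y) (B x y)
  simp only [Matrix.add_apply, Matrix.sub_apply]
  nlinarith

theorem norm_trace_sq_le {ι : Type*} [Fintype ι] (A : Matrix ι ι ℂ) :
    ‖A.trace‖ ^ 2 ≤ Fintype.card ι * frobSq A := by
  have h1 : ‖A.trace‖ ≤ ∑ x, ‖A x x‖ := norm_sum_le _ _
  have h2 := sq_sum_le_card_mul_sum_sq (s := Finset.univ) (f := fun x => ‖A x x‖)
  have h3 : ∑ x, ‖A x x‖ ^ 2 ≤ frobSq A := Finset.sum_le_sum fun x _ =>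
    Finset.single_le_sum (f := fun y => ‖A x y‖ ^ 2) (fun _ _ => by positivity)
      (Finset.mem_univ x)
  rw [Finset.card_univ] at h2
  exact (pow_le_pow_left₀ (norm_nonneg _) h1 2).trans
    (h2.trans (mul_le_mul_of_nonneg_left h3 (by positivity)))

theorem frobSq_eq_sum_qubitBlock (Y : Matrix (Qubits (n + 1)) (Qubits (n + 1)) ℂ) :
    frobSq Y = ∑ a, ∑ b, frobSq (qubitBlock Y a b) := by
  unfold frobSq
  rw [sum_fin_cons]
  refine Finset.sum_congr rfl fun a _ => ?_
  simp_rw [sum_fin_cons (M := ℝ)]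
  rw [Finset.sum_comm]
  rfl

theorem trace_eq_trace_qubitBlock (Y : Matrix (Qubits (n + 1)) (Qubits (n + 1)) ℂ) :
    Y.trace = (qubitBlock Y 0 0).trace + (qubitBlock Y 1 1).trace := by
  simp only [Matrix.trace, Matrix.diag]
  rw [sum_fin_cons, Fin.sum_univ_two]
  rfl

/-- In the Pauli expansion of `Y`, averaging over product stabilizer states damps a term of weight
`w` by `3 ^ (-w)`. The identity keeps weight `1 = 1/3 + 2/3`, and all other terms keep at most
`1/3`. The induction realizes this one qubit at a time: the 2-design identity reduces to the blocks
`A`, `B`, `C`, `D` and `A + B`. Parallelogram laws remove `A + B` in favour of `A - B`, and `|tr M|²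
≤ 2^n ‖M‖²` handles `C`, `D` and `A - B`. -/
theorem sum_norm_stabExpect_sq_le (Y : Matrix (Qubits n) (Qubits n) ℂ) :
    ∑ s, ‖stabExpect Y s‖ ^ 2 ≤
      6 ^ n * (1 / 3 * (frobSq Y / 2 ^ n) + 2 / 3 * (‖Y.trace‖ ^ 2 / 4 ^ n)) := by
  induction n with
  | zero =>
    obtain ⟨z, hz⟩ : ∃ z, ∀ x y, Y x y = z :=
      ⟨Y 0 0, fun x y => by rw [Subsingleton.elim x 0, Subsingleton.elim y 0]⟩
    simp [frobSq, Matrix.trace, stabExpect, hz]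
    linarith
  | succ n ih =>
    set A := qubitBlock Y 0 0 with hA
    set B := qubitBlock Y 1 1 with hB
    set C := qubitBlock Y 0 1
    set D := qubitBlock Y 1 0
    have hsum : ∑ s, ‖stabExpect Y s‖ ^ 2 = ∑ s, ‖stabExpect (A + B) s‖ ^ 2 +
        (∑ s, ‖stabExpect A s‖ ^ 2 + ∑ s, ‖stabExpect C s‖ ^ 2 +
          (∑ s, ‖stabExpect D s‖ ^ 2 + ∑ s, ‖stabExpect B s‖ ^ 2)) := by
      rw [sum_fin_cons, Finset.sum_comm]
      simp only [← Finset.sum_add_distrib]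
      refine Finset.sum_congr rfl fun s _ => ?_
      simp_rw [stabExpect_cons]
      rw [sum_stab_sq fun a b => stabExpect (qubitBlock Y a b) s, Fin.sum_univ_two,
        Fin.sum_univ_two, Fin.sum_univ_two, stabExpect_add]
    have hF : frobSq Y = frobSq A + frobSq C + (frobSq D + frobSq B) := by
      rw [frobSq_eq_sum_qubitBlock, Fin.sum_univ_two, Fin.sum_univ_two, Fin.sum_univ_two]
    have hT : Y.trace = A.trace + B.trace := trace_eq_trace_qubitBlock Y
    have hp := frobSq_add_add_frobSq_sub A B
    have hpt := parallelogram_law_with_norm ℂ A.trace B.trace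
    have hcs : ∀ M : Matrix (Qubits n) (Qubits n) ℂ,
        ‖M.trace‖ ^ 2 / 4 ^ n ≤ frobSq M / 2 ^ n := fun M => by
      have h := norm_trace_sq_le M
      rw [Fintype.card_fun, Fintype.card_fin, Fintype.card_fin] at h
      push_cast at h
      rw [div_le_div_iff₀ (by positivity) (by positivity)]
      have h4 : (4 : ℝ) ^ n = 2 ^ n * 2 ^ n := by rw [← mul_pow]; norm_num
      rw [h4]
      have := mul_le_mul_of_nonneg_right h (by positivity : (0 : ℝ) ≤ 2 ^ n)
      linarith
    have hC := hcs C
    have hD := hcs D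
    have hAB := hcs (A - B)
    rw [Matrix.trace_sub] at hAB
    rw [hsum]
    refine (add_le_add (ih _) (add_le_add (add_le_add (ih _) (ih _))
      (add_le_add (ih _) (ih _)))).trans ?_
    rw [hF, hT, Matrix.trace_add]
    set p : ℝ := (2 ^ n : ℝ)⁻¹ with hpdef
    set t : ℝ := (4 ^ n : ℝ)⁻¹ with htdef
    have h2p : ∀ z : ℝ, z / 2 ^ (n + 1) = z * p / 2 := fun z => by
      rw [hpdef, pow_succ]; field_simp
    have h4p : ∀ z : ℝ, z / 4 ^ (n + 1) = z * t / 4 := fun z => by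
      rw [htdef, pow_succ]; field_simp
    rw [h2p, h4p]
    simp only [div_eq_mul_inv _ ((2 : ℝ) ^ n), div_eq_mul_inv _ ((4 : ℝ) ^ n), ← hpdef, ← htdef]
      at hC hD hAB ⊢
    have hp' : frobSq (A + B) * p + frobSq (A - B) * p = 2 * (frobSq A * p + frobSq B * p) := by
      rw [← add_mul, hp]; ring
    have hpt' : ‖A.trace + B.trace‖ ^ 2 * t + ‖A.trace - B.trace‖ ^ 2 * t =
        2 * (‖A.trace‖ ^ 2 * t + ‖B.trace‖ ^ 2 * t) := by
      rw [← add_mul, hpt]; ring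
    have h6 : (0 : ℝ) ≤ 6 ^ n := by positivity
    rw [pow_succ (6 : ℝ) n]
    have key := mul_nonneg h6 (sub_nonneg.2 hAB)
    have keyC := mul_nonneg h6 (sub_nonneg.2 hC)
    have keyD := mul_nonneg h6 (sub_nonneg.2 hD)
    have hp'' := congrArg (fun z => (6 : ℝ) ^ n * z) hp'
    have hpt'' := congrArg (fun z => (6 : ℝ) ^ n * z) hpt'
    linarith

theorem frobSq_unitary {ι : Type*} [Fintype ι] [DecidableEq ι] (U : unitaryGroup ι ℂ) :
    frobSq (U : Matrix ι ι ℂ) = Fintype.card ι := by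
  unfold frobSq
  rw [Finset.sum_comm]
  have h : ∀ a, ∑ b, ‖(U : Matrix ι ι ℂ) b a‖ ^ 2 = 1 := fun a => by
    have h1 := norm_colVec U a
    have h2 := EuclideanSpace.norm_sq_eq (colVec (U : Matrix ι ι ℂ) a)
    rw [h1] at h2
    simpa [colVec] using h2.symm
  simp [h]

theorem tensor_conj_apply_zero (Y : Matrix (Qubits n) (Qubits n) ℂ) (s : Fin n → Fin 6) :
    ((tensorUnitary (fun i => stabUnitary (s i)) : Matrix (Qubits n) (Qubits n) ℂ)ᴴ * Y *
      (tensorUnitary (fun i => stabUnitary (s i)) : Matrix (Qubits n) (Qubits n) ℂ)) 0 0 =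
      stabExpect Y s := by
  rw [Matrix.mul_assoc, Matrix.mul_apply]
  refine Finset.sum_congr rfl fun x _ => ?_
  rw [Matrix.mul_apply, Finset.mul_sum]
  refine Finset.sum_congr rfl fun y _ => ?_
  simp only [tensorUnitary, Matrix.conjTranspose_apply, Matrix.of_apply, Pi.zero_apply,
    stabUnitary_apply_zero]
  ring

end Stabilizer

/-! ### Locally scrambled ensembles -/

section Scrambled

variable {n : ℕ}

/-- The pure state `|0⟩⟨0|` on two copies of the `n`-qubit system. -/
def zeroPair (n : ℕ) : DensityMatrix (Qubits n × Qubits n) :=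
  ⟨Matrix.diagonal (Pi.single 0 1),
    Matrix.PosSemidef.diagonal (Pi.single_nonneg.2 zero_le_one),
    by simp [Matrix.trace_diagonal]⟩

theorem kronecker_zeroPair_apply (W : Matrix (Qubits n) (Qubits n) ℂ) (p q : Qubits n × Qubits n) :
    ((W ⊗ₖ W) * (zeroPair n).1 * (W ⊗ₖ W)ᴴ) p q =
      W p.1 0 * W p.2 0 * star (W q.1 0 * W q.2 0) := by
  rw [Matrix.mul_apply]
  simp only [zeroPair, Matrix.mul_diagonal, Matrix.conjTranspose_apply]
  rw [Finset.sum_eq_single 0]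
  · simp [Matrix.kroneckerMap_apply]
  · intro c _ hc
    simp [hc]
  · simp

/-- `|⟨0|W† X W|0⟩|²` as a linear function of the second moment of `W`. -/
theorem norm_conj_apply_sq_eq_sum (X W : Matrix (Qubits n) (Qubits n) ℂ) :
    ((‖(Wᴴ * X * W) 0 0‖ ^ 2 : ℝ) : ℂ) = ∑ a, ∑ b, ∑ c, ∑ d, X a b * star (X c d) *
      ((W ⊗ₖ W) * (zeroPair n).1 * (W ⊗ₖ W)ᴴ) (b, c) (a, d) := by
  have h : (Wᴴ * X * W) 0 0 = ∑ a, ∑ b, star (W a 0) * X a b * W b 0 := by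
    rw [Matrix.mul_assoc, Matrix.mul_apply]
    refine Finset.sum_congr rfl fun a _ => ?_
    rw [Matrix.mul_apply, Finset.mul_sum]
    refine Finset.sum_congr rfl fun b _ => ?_
    rw [Matrix.conjTranspose_apply]
    ring
  rw [Complex.ofReal_pow, ← Complex.mul_conj', h, map_sum, Finset.sum_mul]
  refine Finset.sum_congr rfl fun a _ => ?_
  rw [Finset.sum_mul]
  refine Finset.sum_congr rfl fun b _ => ?_
  rw [Finset.mul_sum]
  refine Finset.sum_congr rfl fun c _ => ?_
  rw [map_sum, Finset.mul_sum]
  refine Finset.sum_congr rfl fun d _ => ?_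
  rw [kronecker_zeroPair_apply]
  simp only [map_mul, star_mul', Complex.star_def, Complex.conj_conj]
  ring

theorem integrable_of_continuous {ν : Measure (QubitUnitary n)} [IsFiniteMeasure ν] {E : Type*}
    [NormedAddCommGroup E] [SecondCountableTopology E] {F : QubitUnitary n → E}
    (hF : Continuous F) : Integrable F ν := by
  borelize E
  obtain ⟨C, hC⟩ := (isCompact_range hF.norm).bddAbove
  exact Integrable.of_bound hF.measurable.aestronglyMeasurable C
    (Filter.Eventually.of_forall fun U => hC ⟨U, rfl⟩)

theorem continuous_kronecker_zeroPair_apply (p q : Qubits n × Qubits n) :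
    Continuous fun W : QubitUnitary n =>
      (((W : Matrix (Qubits n) (Qubits n) ℂ) ⊗ₖ (W : Matrix (Qubits n) (Qubits n) ℂ)) *
        (zeroPair n).1 * ((W : Matrix (Qubits n) (Qubits n) ℂ) ⊗ₖ
          (W : Matrix (Qubits n) (Qubits n) ℂ))ᴴ) p q := by
  simp only [kronecker_zeroPair_apply]
  have h : ∀ a b, Continuous fun W : QubitUnitary n => (W : Matrix (Qubits n) (Qubits n) ℂ) a b :=
    fun a b => continuous_subtype_val.matrix_elem a b
  exact ((h _ _).mul (h _ _)).mul ((h _ _).mul (h _ _)).star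

/-- The right side sees `ν` only through its second moment, which permits replacing `ν` by a locally
invariant ensemble. -/
theorem integral_norm_conj_apply_sq (ν : Measure (QubitUnitary n)) [IsFiniteMeasure ν]
    (X : Matrix (Qubits n) (Qubits n) ℂ) :
    ((∫ W : QubitUnitary n, ‖((W : Matrix (Qubits n) (Qubits n) ℂ)ᴴ * X * W) 0 0‖ ^ 2 ∂ν : ℝ) : ℂ) =
      ∑ a, ∑ b, ∑ c, ∑ d, X a b * star (X c d) * secondMoment ν (zeroPair n) (b, c) (a, d) := by
  rw [← integral_complex_ofReal]
  simp only [norm_conj_apply_sq_eq_sum]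
  have hi : ∀ a b c d, Integrable (fun W : QubitUnitary n => X a b * star (X c d) *
      (((W : Matrix (Qubits n) (Qubits n) ℂ) ⊗ₖ (W : Matrix (Qubits n) (Qubits n) ℂ)) *
        (zeroPair n).1 * ((W : Matrix (Qubits n) (Qubits n) ℂ) ⊗ₖ
          (W : Matrix (Qubits n) (Qubits n) ℂ))ᴴ) (b, c) (a, d)) ν := fun a b c d =>
    integrable_of_continuous (continuous_const.mul (continuous_kronecker_zeroPair_apply _ _))
  rw [integral_finsetSum _ fun a _ => integrable_finsetSum _ fun b _ =>
    integrable_finsetSum _ fun c _ => integrable_finsetSum _ fun d _ => hi a b c d]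
  refine Finset.sum_congr rfl fun a _ => ?_
  rw [integral_finsetSum _ fun b _ =>
    integrable_finsetSum _ fun c _ => integrable_finsetSum _ fun d _ => hi a b c d]
  refine Finset.sum_congr rfl fun b _ => ?_
  rw [integral_finsetSum _ fun c _ => integrable_finsetSum _ fun d _ => hi a b c d]
  refine Finset.sum_congr rfl fun c _ => ?_
  rw [integral_finsetSum _ fun d _ => hi a b c d]
  refine Finset.sum_congr rfl fun d _ => ?_
  rw [integral_const_mul]
  rfl

theorem continuous_norm_conj_apply_sq (X : Matrix (Qubits n) (Qubits n) ℂ) :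
    Continuous fun W : QubitUnitary n =>
      ‖((W : Matrix (Qubits n) (Qubits n) ℂ)ᴴ * X * W) 0 0‖ ^ 2 :=
  ((((continuous_subtype_val.matrix_conjTranspose.matrix_mul continuous_const).matrix_mul
    continuous_subtype_val).matrix_elem 0 0).norm).pow 2

/-- The second moment bound for ensembles that are invariant under local unitaries. -/
theorem integral_norm_conj_apply_sq_le {ν : Measure (QubitUnitary n)} [IsProbabilityMeasure ν]
    (hν : ∀ V : Fin n → unitaryGroup (Fin 2) ℂ, ν.map (fun U => U * tensorUnitary V) = ν)
    (X : QubitUnitary n) :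
    ∫ W : QubitUnitary n, ‖((W : Matrix (Qubits n) (Qubits n) ℂ)ᴴ *
      (X : Matrix (Qubits n) (Qubits n) ℂ) * W) 0 0‖ ^ 2 ∂ν ≤
      1 / 3 + 2 / 3 * (‖(X : Matrix (Qubits n) (Qubits n) ℂ).trace‖ ^ 2 / 4 ^ n) := by
  set h : QubitUnitary n → ℝ := fun W => ‖((W : Matrix (Qubits n) (Qubits n) ℂ)ᴴ *
      (X : Matrix (Qubits n) (Qubits n) ℂ) * W) 0 0‖ ^ 2 with hh
  have hc : Continuous h := continuous_norm_conj_apply_sq _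
  let T : (Fin n → Fin 6) → QubitUnitary n := fun s => tensorUnitary fun i => stabUnitary (s i)
  have hmul : ∀ s, Continuous fun W : QubitUnitary n => W * T s := fun s =>
    Continuous.subtype_mk (continuous_subtype_val.matrix_mul continuous_const) _
  -- Local invariance lets each of the `6 ^ n` stabilizer preparations be inserted for free. Their
  -- sum is then bounded pointwise in `W`.
  have hinv : ∀ s, ∫ W, h W ∂ν = ∫ W, h (W * T s) ∂ν := fun s => by
    conv_lhs => rw [← hν fun i => stabUnitary (s i)]
    exact integral_map (hmul s).measurable.aemeasurable hc.measurable.aestronglyMeasurable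
  have hval : ∀ s W, h (W * T s) = ‖stabExpect ((W : Matrix (Qubits n) (Qubits n) ℂ)ᴴ *
      (X : Matrix (Qubits n) (Qubits n) ℂ) * (W : Matrix (Qubits n) (Qubits n) ℂ)) s‖ ^ 2 := by
    intro s W
    rw [← tensor_conj_apply_zero]
    simp [hh, T, Matrix.conjTranspose_mul, Matrix.mul_assoc]
  have hpt : ∀ W, ∑ s, h (W * T s) ≤ 6 ^ n *
      (1 / 3 + 2 / 3 * (‖(X : Matrix (Qubits n) (Qubits n) ℂ).trace‖ ^ 2 / 4 ^ n)) := by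
    intro W
    simp only [hval]
    refine (sum_norm_stabExpect_sq_le _).trans (le_of_eq ?_)
    have h1 : frobSq ((W : Matrix (Qubits n) (Qubits n) ℂ)ᴴ *
        (X : Matrix (Qubits n) (Qubits n) ℂ) * (W : Matrix (Qubits n) (Qubits n) ℂ)) = 2 ^ n := by
      have := frobSq_unitary (W⁻¹ * X * W)
      simpa [Matrix.star_eq_conjTranspose] using this
    have h2 : ((W : Matrix (Qubits n) (Qubits n) ℂ)ᴴ *
        (X : Matrix (Qubits n) (Qubits n) ℂ) * (W : Matrix (Qubits n) (Qubits n) ℂ)).trace =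
        (X : Matrix (Qubits n) (Qubits n) ℂ).trace := by
      have hW : (W : Matrix (Qubits n) (Qubits n) ℂ) * (W : Matrix (Qubits n) (Qubits n) ℂ)ᴴ = 1 :=
        mem_unitaryGroup_iff.1 W.2
      rw [Matrix.trace_mul_comm, ← Matrix.mul_assoc, hW, Matrix.one_mul]
    rw [h1, h2, div_self (by positivity), mul_one]
  have hsum : (6 : ℝ) ^ n * ∫ W, h W ∂ν = ∫ W, ∑ s, h (W * T s) ∂ν := by
    have hi : ∀ s, Integrable (fun W => h (W * T s)) ν := fun s =>
      integrable_of_continuous (hc.comp (hmul s))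
    rw [integral_finsetSum _ fun s _ => hi s, ← Finset.sum_congr rfl fun s _ => hinv s]
    simp
  have hle : ∫ W, ∑ s, h (W * T s) ∂ν ≤ 6 ^ n *
      (1 / 3 + 2 / 3 * (‖(X : Matrix (Qubits n) (Qubits n) ℂ).trace‖ ^ 2 / 4 ^ n)) := by
    have := integral_mono (μ := ν)
      (integrable_of_continuous (continuous_finsetSum _ fun s _ => hc.comp (hmul s)))
      (integrable_const _) hpt
    simpa using this
  rw [← hsum] at hle
  exact le_of_mul_le_mul_left hle (by positivity)

theorem IsLocallyScrambled.isProbabilityMeasure {P : Measure (DensityMatrix (Qubits n))}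
    (hP : IsLocallyScrambled P) : IsProbabilityMeasure P := by
  obtain ⟨ν, hν, -, rfl⟩ := hP
  exact Measure.isProbabilityMeasure_map (continuous_conjState_left _).measurable.aemeasurable

theorem IsLocallyScrambled.support_subset {P : Measure (DensityMatrix (Qubits n))}
    (hP : IsLocallyScrambled P) :
    P.support ⊆ Set.range fun U : QubitUnitary n => conjState U (zeroState n) := by
  obtain ⟨ν, -, -, rfl⟩ := hP
  exact support_map_conjState_subset ν

/-- On a locally scrambled ensemble the root mean squared trace distance dominates the
dimension-normalized Hilbert-Schmidt distance up to a phase. -/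
theorem IsLocallyScrambled.infidelity_le_rmsDist_sq {P : Measure (DensityMatrix (Qubits n))}
    (hP : IsLocallyScrambled P) (U V : QubitUnitary n) :
    2 / 3 * infidelity U V ≤ rmsDist P (conjState U) (conjState V) ^ 2 := by
  obtain ⟨ν, hν, ⟨ν', hν', hinv, hmom⟩, rfl⟩ := hP
  set X : QubitUnitary n := U⁻¹ * V with hX
  have hXc : (X : Matrix (Qubits n) (Qubits n) ℂ) =
      (U : Matrix (Qubits n) (Qubits n) ℂ)ᴴ * (V : Matrix (Qubits n) (Qubits n) ℂ) := by
    simp [hX, Matrix.star_eq_conjTranspose]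
  have hint : ∫ ρ, traceDist (conjState U ρ) (conjState V ρ) ^ 2
      ∂(ν.map fun W => conjState W (zeroState n)) =
      1 - ∫ W : QubitUnitary n, ‖((W : Matrix (Qubits n) (Qubits n) ℂ)ᴴ *
        (X : Matrix (Qubits n) (Qubits n) ℂ) * W) 0 0‖ ^ 2 ∂ν := by
    rw [integral_map (continuous_conjState_left _).measurable.aemeasurable
      ((measurable_traceDist_comp (continuous_conjState_right U).measurable
        (continuous_conjState_right V).measurable).pow_const 2).aestronglyMeasurable]
    simp only [conjState_mul, traceDist_conjState_zeroState_sq]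
    rw [integral_sub (integrable_const _)]
    · congr 1
      · simp
      · refine integral_congr_ae (Filter.Eventually.of_forall fun W => ?_)
        simp [hXc, Matrix.conjTranspose_mul, Matrix.mul_assoc]
    · have := integrable_of_continuous (ν := ν)
        (continuous_norm_conj_apply_sq (X : Matrix (Qubits n) (Qubits n) ℂ))
      simpa [hXc, Matrix.conjTranspose_mul, Matrix.mul_assoc] using this
  have hmomeq : ∫ W : QubitUnitary n, ‖((W : Matrix (Qubits n) (Qubits n) ℂ)ᴴ *
        (X : Matrix (Qubits n) (Qubits n) ℂ) * W) 0 0‖ ^ 2 ∂ν =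
      ∫ W : QubitUnitary n, ‖((W : Matrix (Qubits n) (Qubits n) ℂ)ᴴ *
        (X : Matrix (Qubits n) (Qubits n) ℂ) * W) 0 0‖ ^ 2 ∂ν' := by
    apply Complex.ofReal_injective
    rw [integral_norm_conj_apply_sq, integral_norm_conj_apply_sq, hmom]
  have hle := integral_norm_conj_apply_sq_le hinv X
  rw [rmsDist, Real.sq_sqrt (integral_nonneg fun _ => sq_nonneg _), hint, hmomeq]
  unfold infidelity
  rw [← hXc, Fintype.card_fun, Fintype.card_fin, Fintype.card_fin]
  push_cast
  rw [← pow_mul, mul_comm n 2, pow_mul]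
  norm_num at hle ⊢
  linarith

/-- Learning an arbitrary unitary on a locally scrambled ensemble needs exponentially many
samples. -/
theorem Learns.le_samples {n : ℕ} (hn : 1 ≤ n) {P : Measure (DensityMatrix (Qubits n))}
    (hP : IsLocallyScrambled P) {a ε η : ℝ} (ha : 0 < a) (hε : 0 < ε) (hη : 0 < η)
    (haη : a * ε ≤ η) (hδ : 2 * ε + 6 * η ≤ 1 / 320) {N : ℕ} {Ω : Type*} [MeasurableSpace Ω]
    {μ : Measure Ω} [IsProbabilityMeasure μ]
    {H : Learner Ω P.support (DensityMatrix (Qubits n)) (QubitUnitary n)}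
    (hL : Learns μ conjState Set.univ P.support P ε η N H) :
    1 / (16 * (1 + Real.log (60 * (2 / a + 6)) / Real.log 16)) * 2 ^ n ≤ (N : ℝ) := by
  classical
  have := hP.isProbabilityMeasure
  set x := 2 * ε + 6 * η with hx
  have hx0 : 0 < x := by positivity
  obtain ⟨m, rfl⟩ : ∃ m, n = m + 1 := ⟨n - 1, by omega⟩
  have hS : ∀ᵐ ρ ∂P, ρ ∈ P.support := Measure.support_mem_ae
  obtain ⟨hMfin, hNfin, hmain⟩ := hL.log_packingNumber_le (r := x)
    (fun V => (continuous_conjState_right V).measurable) hS hη (by linarith)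
  obtain ⟨t, htsep, htpos, htlog⟩ := exists_separated_unitaries (ι := Qubits (m + 1)) (L := 2 ^ m)
    Nat.one_le_two_pow (by simp [pow_succ, mul_comm]) hx0 hδ
  -- The factors cancel: `d_P² ≥ (2/3) · infidelity > (2/3)(3/2) x² = x²`.
  have hsep : ∀ U ∈ t, ∀ V ∈ t, U ≠ V → x < rmsDist P (conjState U) (conjState V) := by
    intro U hU V hV hne
    have h1 := hP.infidelity_le_rmsDist_sq U V
    have h2 : 3 / 2 * x ^ 2 < infidelity U V := htsep hU hV hne
    exact lt_of_pow_lt_pow_left₀ 2 (Real.sqrt_nonneg _) (by linarith)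
  have hinj : Set.InjOn (conjState (ι := Qubits (m + 1))) (t : Set (QubitUnitary (m + 1))) := by
    intro U hU V hV h
    by_contra hne
    have := hsep U hU V hV hne
    rw [h, rmsDist_self] at this
    linarith
  have hM := card_le_packingNumber (K := conjState '' (Set.univ : Set (QubitUnitary (m + 1))))
    (d := rmsDist P) (r := x) (t.image conjState)
    (by rw [Finset.coe_image]; exact Set.image_mono (Set.subset_univ _))
    (by
      intro f hf g hg hfg
      rw [Finset.mem_coe, Finset.mem_image] at hf hg
      obtain ⟨U, hU, rfl⟩ := hf
      obtain ⟨V, hV, rfl⟩ := hg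
      exact hsep U hU V hV fun h => hfg (by rw [h]))
  rw [Finset.card_image_of_injOn hinj, ← ENat.natCast_toNat hMfin] at hM
  have hM' : t.card ≤ (packingNumber (conjState '' (Set.univ : Set (QubitUnitary (m + 1))))
    (rmsDist P) x).toNat := by exact_mod_cast hM
  have hlogM := Real.log_le_log (by exact_mod_cast htpos) (Nat.cast_le (α := ℝ).2 hM')
  have hcov : maxCoveringNumber conjState (Set.univ : Set (QubitUnitary (m + 1))) P.support η ≤
      (⌊(1 + 2 / η) ^ (2 * 2 ^ (m + 1))⌋₊ : ℕ) := by
    refine iSup₂_le fun ρ hρ => coveringNumber_pure_le hη ?_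
    obtain ⟨W, rfl⟩ := hP.support_subset hρ
    rintro _ ⟨V, -, rfl⟩
    exact ⟨V * W, by simp only [conjState_mul]⟩
  rw [← ENat.natCast_toNat hNfin] at hcov
  set q := (maxCoveringNumber conjState (Set.univ : Set (QubitUnitary (m + 1))) P.support η).toNat
  have hq : (q : ℝ) ≤ (1 + 2 / η) ^ (2 * 2 ^ (m + 1)) := by
    have h1 : q ≤ ⌊(1 + 2 / η) ^ (2 * 2 ^ (m + 1))⌋₊ := by exact_mod_cast hcov
    exact (Nat.cast_le.2 h1).trans (Nat.floor_le (by positivity))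
  have hη1 : η ≤ 1 := by linarith
  have hlogq : Real.log q ≤ 2 * 2 ^ (m + 1) * Real.log (3 / η) := by
    rcases Nat.eq_zero_or_pos q with h | h
    · rw [h, Nat.cast_zero, Real.log_zero]
      have : 0 ≤ Real.log (3 / η) := Real.log_nonneg (by rw [le_div_iff₀ hη]; linarith)
      positivity
    · have h3 : 1 + 2 / η ≤ 3 / η := by
        rw [le_div_iff₀ hη, add_mul, div_mul_cancel₀ _ hη.ne']
        linarith
      have h4 := Real.log_le_log (by exact_mod_cast h)
        (hq.trans (pow_le_pow_left₀ (by positivity) h3 _))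
      rw [Real.log_pow] at h4
      push_cast at h4
      exact h4
  set ℓ := Real.log (1 / (20 * x)) with hℓ
  set A := Real.log (60 * (2 / a + 6)) with hA
  have hl16 : 0 < Real.log 16 := Real.log_pos (by norm_num)
  have hℓ16 : Real.log 16 ≤ ℓ :=
    Real.log_le_log (by norm_num) (by rw [le_div_iff₀ (by positivity)]; linarith)
  have hA0 : 0 ≤ A := Real.log_nonneg (by
    have : 0 < 2 / a := by positivity
    linarith)
  -- From `ε ≤ η / a` follows `x ≤ (2/a + 6) η`, hence `log (3/η) ≤ ℓ + A`. As `ℓ ≥ log 16`, the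
  -- additive `A` becomes a multiplicative constant.
  have hlog3 : Real.log (3 / η) ≤ ℓ * (1 + A / Real.log 16) := by
    have hεη : ε ≤ η / a := by rw [le_div_iff₀ ha]; linarith
    have hxη : x ≤ (2 / a + 6) * η := by
      have : (2 / a + 6) * η = 2 * (η / a) + 6 * η := by ring
      rw [this]
      linarith
    have h1 : 3 / η ≤ 1 / (20 * x) * (60 * (2 / a + 6)) := by
      rw [div_mul_eq_mul_div, div_le_div_iff₀ hη (by positivity)]
      linarith
    have h2 := Real.log_le_log (by positivity) h1
    rw [Real.log_mul (by positivity) (by positivity), ← hℓ, ← hA] at h2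
    have h3 : A ≤ ℓ * (A / Real.log 16) := by
      rw [mul_div_assoc', le_div_iff₀ hl16]
      nlinarith
    linarith
  set κ := 1 + A / Real.log 16 with hκ
  have hκ0 : 0 < κ := by positivity
  have hℓ0 : 0 < ℓ := hl16.trans_le hℓ16
  have hfin : 1 / 2 * ((2 ^ m : ℝ) ^ 2 * ℓ) ≤ N * (2 * 2 ^ (m + 1) * (ℓ * κ)) := by
    push_cast at htlog
    calc 1 / 2 * ((2 ^ m : ℝ) ^ 2 * ℓ) ≤ N * Real.log q := by linarith
      _ ≤ N * (2 * 2 ^ (m + 1) * (ℓ * κ)) := by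
        refine mul_le_mul_of_nonneg_left (hlogq.trans ?_) (by positivity)
        exact mul_le_mul_of_nonneg_left hlog3 (by positivity)
  rw [div_mul_eq_mul_div, one_mul, div_le_iff₀ (by positivity), pow_succ]
  -- Dividing by `2^m ℓ / 2` leaves `2^(m+1) ≤ 16 κ N`; the factor `ℓ` cancels, so no dependence on
  -- `ε` or `η` remains.
  have hcancel : (2 ^ m * ℓ / 2) * (2 ^ m * 2 : ℝ) ≤ (2 ^ m * ℓ / 2) * (N * (16 * κ)) := by
    rw [pow_succ (2 : ℝ) m] at hfin
    linarith
  exact le_of_mul_le_mul_left hcancel (by positivity)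

end Scrambled

end QNFL

end

open MeasureTheory QNFL in
theorem mainTheorem8 :
    (∃ c : ℝ, 0 < c ∧
      ∀ (n : ℕ) (ι : Type*) [Fintype ι] (κ : Type*) [Fintype κ] [DecidableEq κ]
        (f : QubitUnitary n → DensityMatrix ι → DensityMatrix κ) (_ : ∀ V, Measurable (f V))
        (𝒰 : Set (QubitUnitary n)) (S : Set (DensityMatrix ι))
        (P : Measure (DensityMatrix ι)) [IsProbabilityMeasure P] (_ : ∀ᵐ ρ ∂P, ρ ∈ S)
        (ε η : ℝ) (_ : ε ∈ Set.Ioo (0 : ℝ) 1) (_ : η ∈ Set.Ioo (0 : ℝ) 1) (N : ℕ)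
        (Ω : Type*) [MeasurableSpace Ω] (μ : Measure Ω) [IsProbabilityMeasure μ]
        (H : Learner Ω S (DensityMatrix κ) (QubitUnitary n)),
        Learns μ f 𝒰 S P ε η N H →
          packingNumber (f '' 𝒰) (rmsDist P) (2 * ε + 6 * η) ≠ ⊤ ∧
          maxCoveringNumber f 𝒰 S η ≠ ⊤ ∧
          c * Real.log (packingNumber (f '' 𝒰) (rmsDist P) (2 * ε + 6 * η)).toNat ≤
            N * Real.log (maxCoveringNumber f 𝒰 S η).toNat) ∧
    (∃ δ : ℝ, 0 < δ ∧ ∀ a b : ℝ, 0 < a → a ≤ b → ∃ c : ℝ, 0 < c ∧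
      ∀ (n : ℕ) (_ : 1 ≤ n) (P : Measure (DensityMatrix (Qubits n))) (_ : IsLocallyScrambled P)
        (ε η : ℝ) (_ : ε ∈ Set.Ioo (0 : ℝ) 1) (_ : η ∈ Set.Ioo (0 : ℝ) 1)
        (_ : a * ε ≤ η) (_ : η ≤ b * ε) (_ : 2 * ε + 6 * η ≤ δ) (N : ℕ)
        (Ω : Type*) [MeasurableSpace Ω] (μ : Measure Ω) [IsProbabilityMeasure μ]
        (H : Learner Ω P.support (DensityMatrix (Qubits n)) (QubitUnitary n)),
        Learns μ conjState Set.univ P.support P ε η N H → c * 2 ^ n ≤ (N : ℝ)) := by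
  -- The threshold `1 / 320` ensures `20 x ≤ 1 / 16`, the separation scale needed in the packing of
  -- unitaries.
  refine ⟨⟨1 / 2, by norm_num, ?_⟩, 1 / 320, by norm_num, fun a b ha hab => ?_⟩
  · intro n ι _ κ _ _ f hf 𝒰 S P _ hPS ε η _ hη N Ω _ μ _ H hL
    exact hL.log_packingNumber_le hf hPS hη.1 (by linarith [hη.1])
  · refine ⟨1 / (16 * (1 + Real.log (60 * (2 / a + 6)) / Real.log 16)), ?_, ?_⟩
    · have h1 : 0 ≤ Real.log (60 * (2 / a + 6)) := Real.log_nonneg (by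
        have : 0 < 2 / a := by positivity
        linarith)
      have h2 : 0 < Real.log 16 := Real.log_pos (by norm_num)
      positivity
    · intro n hn P hP ε η hε hη haη _ hδ N Ω _ μ _ H hL
      exact hL.le_samples hn hP ha hε.1 hη.1 haη hδ
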